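/- All graphs are finite, undirected, without loops or parallel edges. A graph is claw-free if it has no induced subgraph isomorphic to $K_{1,3}$; it is $3$-connected if it has more than three vertices and remains connected after the deletion of any set of at most two vertices. A $\Lambda$-factor of a graph is a spanning subgraph each of whose components is a path on three vertices. Let $G$ be a $3$-connected claw-free graph whose number of vertices is divisible by $3$. Let $L$ be a $3$-vertex path in $G$ (a subgraph, not necessarily induced) whose centre vertex has degree $3$ in $G$. Then the graph $G-L$, obtained from $G$ by deleting the three vertices of $L$, is connected and has a $\Lambda$-factor. -/

import Mathlib

namespace SimpleGraph

/-- `G` is `k`-connected: it has more than `k` vertices, and deleting fewer than `k` vertices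
always leaves a connected graph. -/
def IsVertexConnected {V : Type*} (G : SimpleGraph V) (k : ℕ) : Prop :=
  (k : ℕ∞) < ENat.card V ∧
    ∀ S : Finset V, S.card < k → (G.induce ((S : Set V)ᶜ)).Connected

/-- `G` is claw-free: no induced subgraph of `G` is isomorphic to the claw `K_{1,3}`. -/
def IsClawFree {V : Type*} (G : SimpleGraph V) : Prop :=
  ¬ (completeBipartiteGraph (Fin 1) (Fin 3)).IsIndContained G

namespace Subgraph

/-- A subgraph `P` of `G` is an `H`-packing of `G` if every component of `P` is isomorphic
to `H`. -/
def IsPacking {V W : Type*} {G : SimpleGraph V} (P : G.Subgraph) (H : SimpleGraph W) : Prop :=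
  ∀ c : P.coe.ConnectedComponent, Nonempty (c.toSimpleGraph ≃g H)

/-- An `H`-factor of `G` is an `H`-packing of `G` that contains all vertices of `G`. -/
def IsFactor {V W : Type*} {G : SimpleGraph V} (P : G.Subgraph) (H : SimpleGraph W) : Prop :=
  P.IsPacking H ∧ P.IsSpanning

end Subgraph

/-- `G` has a `Λ`-factor, where `Λ` is the path on three vertices. -/
def HasLambdaFactor {V : Type*} (G : SimpleGraph V) : Prop :=
  ∃ P : G.Subgraph, P.IsFactor (pathGraph 3)

end SimpleGraph

/-! Call a nonempty part of a graph an end if at most one vertex attaches it to the rest, and call a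
connected graph without three disjoint ends a chain. Deleting `L` leaves a chain, and every
claw-free chain of order divisible by 3 splits into 3-vertex paths.

Let `c` be the centre of `L`, let `a`, `b` be its other vertices and `d` the third neighbour of `c`.
An end of `G - L` avoiding `d` contains a neighbour of `a`; otherwise `b` and its attaching vertex
would separate it. Two disjoint such ends give two neighbours of `a` not adjacent to `c`, hence
adjacent to each other, whereas three disjoint ends of a connected graph are pairwise non-adjacent
(`ConnOn.not_adj_ends`). So of three disjoint ends at most one contains `d` and at most one avoids
it, which is absurd (`TriconnOn.chainOn_sdiff`).

The partition theorem `ChainOn.lambdaPartition` goes by induction on the order. Claw-freeness makes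
the neighbours of a cut vertex on either side a clique (`IsSep.cliqueNbrs`), so the sides of a cut
are again chains, with or without the cut vertices; residues modulo 3 decide where the cut vertices
go. If no two vertices separate, some edge can be deleted with both its vertices so that no cut
vertex arises (`TriconnOn.exists_contractible`); a path extending this edge is removed, since
deleting one more vertex leaves a chain (`BiconnOn.chainOn_erase`). There remain the chains in which
each cut vertex only cuts off a leaf: a graph without cut vertices plus one or two leaves. With one
leaf, a path starting there is removed. With two leaves at `s` and `t`, a maximal piece attached by
two vertices away from `s` and `t` is split off; maximality makes every end of the rest contain `s`
or `t`, so the rest with its leaves is a chain. If there is no such piece, a path starting at a leaf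
is removed. -/

set_option linter.unusedSectionVars false

namespace SimpleGraph

variable {V : Type*} [DecidableEq V] (G : SimpleGraph V)

/-- Every neighbour in `S` of a vertex of `E` lies in `E` or in `T`. -/
def NbrsWithin (S E T : Finset V) : Prop :=
  ∀ e ∈ E, ∀ v ∈ S, G.Adj e v → v ∈ E ∨ v ∈ T

/-- `G[S]` is connected or empty. -/
def ConnOn (S : Finset V) : Prop :=
  ∀ E ⊆ S, E.Nonempty → G.NbrsWithin S E ∅ → S ⊆ E

/-- No vertex separates `G[S]`. -/
def BiconnOn (S : Finset V) : Prop :=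
  ∀ E ⊆ S, E.Nonempty → ∀ u, G.NbrsWithin S E {u} → S ⊆ insert u E

/-- No two vertices separate `G[S]`. -/
def TriconnOn (S : Finset V) : Prop :=
  ∀ E ⊆ S, E.Nonempty → ∀ u v, G.NbrsWithin S E {u, v} → S ⊆ insert u (insert v E)

/-- `E` is a nonempty part of `S` attached to the rest of `S` by at most one vertex. -/
def IsEnd (S E : Finset V) : Prop :=
  E ⊆ S ∧ E.Nonempty ∧ ∃ u, G.NbrsWithin S E {u}

/-- `G[S]` is connected and its blocks form a chain: there are no three disjoint ends. -/
def ChainOn (S : Finset V) : Prop :=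
  G.ConnOn S ∧ ∀ E₁ E₂ E₃, G.IsEnd S E₁ → G.IsEnd S E₂ → G.IsEnd S E₃ →
    Disjoint E₁ E₂ → Disjoint E₁ E₃ → Disjoint E₂ E₃ → False

/-- Among three neighbours of a vertex, two are adjacent. -/
def NoClaw : Prop :=
  ∀ y a b c, G.Adj y a → G.Adj y b → G.Adj y c → a ≠ b → a ≠ c → b ≠ c →
    G.Adj a b ∨ G.Adj a c ∨ G.Adj b c

/-- The neighbours of `x` in `S` are pairwise adjacent. -/
def CliqueNbrs (S : Finset V) (x : V) : Prop :=
  ∀ u ∈ S, ∀ v ∈ S, G.Adj x u → G.Adj x v → u ≠ v → G.Adj u v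

/-- `S` can be partitioned into triples that span a path on three vertices. -/
inductive LambdaPartition : Finset V → Prop
  | empty : LambdaPartition ∅
  | insert {S : Finset V} {x y z : V} (hx : x ∉ S) (hy : y ∉ S) (hz : z ∉ S) (hxz : x ≠ z)
      (hxy : G.Adj x y) (hyz : G.Adj y z) (h : LambdaPartition S) :
      LambdaPartition (insert x (insert y (insert z S)))

variable {G}

/-! ### Partitions into 3-vertex paths -/

theorem LambdaPartition.union {S T : Finset V} (hS : G.LambdaPartition S)
    (hT : G.LambdaPartition T) (h : Disjoint S T) : G.LambdaPartition (S ∪ T) := by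
  induction hS with
  | empty => simpa using hT
  | @insert S x y z hx hy hz hxz hxy hyz _ ih =>
    have hd : Disjoint S T := by
      rw [Finset.disjoint_left] at h ⊢
      grind
    have := LambdaPartition.insert (S := S ∪ T) (x := x) (y := y) (z := z)
      (by rw [Finset.disjoint_left] at h; grind) (by rw [Finset.disjoint_left] at h; grind)
      (by rw [Finset.disjoint_left] at h; grind) hxz hxy hyz (ih hd)
    simpa [Finset.insert_union] using this

theorem LambdaPartition.exists_path {S : Finset V} (hS : G.LambdaPartition S) {r : V}
    (hr : r ∈ S) : ∃ x y z, x ∈ S ∧ y ∈ S ∧ z ∈ S ∧ x ≠ z ∧ G.Adj x y ∧ G.Adj y z ∧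
      (r = x ∨ r = y ∨ r = z) ∧ G.LambdaPartition (S \ {x, y, z}) := by
  induction hS with
  | empty => simp at hr
  | @insert S x y z hx hy hz hxz hxy hyz hS ih =>
    by_cases h : r = x ∨ r = y ∨ r = z
    · refine ⟨x, y, z, by simp, by simp, by simp, hxz, hxy, hyz, h, ?_⟩
      convert hS using 1
      ext v; grind
    · obtain ⟨x', y', z', hx', hy', hz', h1, h2, h3, h4, h5⟩ := ih (by grind)
      refine ⟨x', y', z', by grind, by grind, by grind, h1, h2, h3, h4, ?_⟩
      have := LambdaPartition.insert (S := S \ {x', y', z'}) (x := x) (y := y) (z := z)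
        (by grind) (by grind) (by grind) hxz hxy hyz h5
      convert this using 1
      clear this ih h5
      ext v
      have : v ∈ S → v ≠ x ∧ v ≠ y ∧ v ≠ z := by grind
      simp only [Finset.mem_insert, Finset.mem_sdiff, Finset.mem_singleton]
      grind

/-- A triple removed from `S`. -/
theorem LambdaPartition.of_sdiff {S : Finset V} {x y z : V} (hx : x ∈ S) (hy : y ∈ S) (hz : z ∈ S)
    (hxz : x ≠ z) (hxy : G.Adj x y) (hyz : G.Adj y z) (h : G.LambdaPartition (S \ {x, y, z})) :
    G.LambdaPartition S := by
  have := LambdaPartition.insert (x := x) (y := y) (z := z) (by simp) (by simp) (by simp)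
    hxz hxy hyz h
  convert this using 1
  ext v; grind

/-- With a single neighbour, `r` cannot be the centre of its path, so `x` is. -/
theorem LambdaPartition.of_leaf {S : Finset V} (hS : G.LambdaPartition S) {r x : V}
    (hr : r ∈ S) (hrx : ∀ v ∈ S, G.Adj r v → v = x) :
    ∃ y ∈ S, y ≠ r ∧ y ≠ x ∧ G.Adj x y ∧ G.LambdaPartition (S \ {r, x, y}) := by
  obtain ⟨a, b, c, ha, hb, hc, hac, hab, hbc, h, hp⟩ := hS.exists_path hr
  rcases h with rfl | rfl | rfl
  · obtain rfl := hrx b hb hab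
    exact ⟨c, hc, hac.symm, hbc.ne', hbc, hp⟩
  · exact absurd ((hrx a ha hab.symm).trans (hrx c hc hbc).symm) hac
  · obtain rfl := hrx b hb hbc.symm
    refine ⟨a, ha, hac, hab.ne, hab.symm, ?_⟩
    convert hp using 2
    ext v; grind

theorem ConnOn.lambdaPartition_of_card {S : Finset V} (hS : G.ConnOn S) (h : S.card = 3) :
    G.LambdaPartition S := by
  obtain ⟨x, y, z, hxy, hxz, hyz, rfl⟩ := Finset.card_eq_three.1 h
  have key : ∀ a ∈ ({x, y, z} : Finset V), ∃ b ∈ ({x, y, z} : Finset V), G.Adj a b := by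
    intro a ha
    by_contra! hcon
    have := hS {a} (by simpa using ha) (by simp) (by
      intro e he v hv hev
      simp at he; subst he
      exact absurd hev (hcon v hv))
    have := Finset.card_le_card this
    simp [h] at this
  have fin : ∀ a b c : V, ({a, b, c} : Finset V) = {x, y, z} → a ≠ c → G.Adj a b → G.Adj b c →
      G.LambdaPartition {x, y, z} := by
    intro a b c he hac hab hbc
    rw [← he]
    exact .of_sdiff (x := a) (y := b) (z := c) (by simp) (by simp) (by simp) hac hab hbc
      (by simpa using LambdaPartition.empty)
  have f1 := fin x y z rfl hxz
  have f2 := fin x z y (by ext; grind) hxy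
  have f3 := fin y x z (by ext; grind) hyz
  have kx := key x (by simp)
  have ky := key y (by simp)
  have kz := key z (by simp)
  simp only [Finset.mem_insert, Finset.mem_singleton, exists_eq_or_imp, exists_eq_left] at kx ky kz
  rcases kx with h | h | h
  · exact absurd h G.irrefl
  · rcases kz with h' | h' | h'
    · exact f3 h.symm h'.symm
    · exact f1 h h'.symm
    · exact absurd h' G.irrefl
  · rcases ky with h' | h' | h'
    · exact f3 h' h
    · exact absurd h' G.irrefl
    · exact f2 h h'.symm

/-! ### Ends of connected graphs -/

/-- Two disjoint adjacent ends cover everything. -/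
theorem ConnOn.subset_union {S E₁ E₂ : Finset V} (hS : G.ConnOn S) (h₁ : G.IsEnd S E₁)
    (h₂ : G.IsEnd S E₂) (hd : Disjoint E₁ E₂) {a b : V} (ha : a ∈ E₁) (hb : b ∈ E₂)
    (hab : G.Adj a b) : S ⊆ E₁ ∪ E₂ := by
  obtain ⟨s1, -, u, hu⟩ := h₁
  obtain ⟨s2, -, v, hv⟩ := h₂
  rw [Finset.disjoint_left] at hd
  -- Since `b ∉ E₁`, the vertex attaching `E₁` is `b`; likewise `a` attaches `E₂`. Hence no edge
  -- leaves the union.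
  have hu' := hu a ha b (s2 hb) hab
  have hv' := hv b hb a (s1 ha) hab.symm
  refine hS _ (Finset.union_subset s1 s2) ⟨a, by simp [ha]⟩ ?_
  intro e he w hw hew
  have := hu e
  have := hv e
  grind

/-- Two ends that meet the clique-neighbourhood of `x` and a third end cannot be disjoint. -/
theorem ConnOn.not_two_ends {S E₁ E₂ E₃ : Finset V} (hS : G.ConnOn S) (h₁ : G.IsEnd S E₁)
    (h₂ : G.IsEnd S E₂) (h₃ : E₃ ⊆ S) (hn : E₃.Nonempty) (d12 : Disjoint E₁ E₂)
    (d13 : Disjoint E₁ E₃) (d23 : Disjoint E₂ E₃) {x a b : V} (hx : G.CliqueNbrs S x) (ha : a ∈ E₁)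
    (hb : b ∈ E₂) (hxa : G.Adj x a) (hxb : G.Adj x b) : False := by
  have hab := hx a (h₁.1 ha) b (h₂.1 hb) hxa hxb (fun h => by
    subst h; exact Finset.disjoint_left.1 d12 ha hb)
  have := hS.subset_union h₁ h₂ d12 ha hb hab
  obtain ⟨c, hc⟩ := hn
  have := this (h₃ hc)
  rw [Finset.disjoint_left] at d13 d23
  grind

theorem CliqueNbrs.mono {S T : Finset V} {x : V} (h : G.CliqueNbrs S x) (hT : T ⊆ S) :
    G.CliqueNbrs T x := fun u hu v hv => h u (hT hu) v (hT hv)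

theorem NbrsWithin.compl {S E : Finset V} (h : G.NbrsWithin S E ∅) :
    G.NbrsWithin S (S \ E) ∅ := by
  intro e he v hv hev
  have := h v
  have := hev.symm
  grind

theorem connOn_of_forall {S : Finset V} (h : ∀ E ⊆ S, E.Nonempty → (S \ E).Nonempty →
    G.NbrsWithin S E ∅ → False) : G.ConnOn S := by
  intro E hE hn hb v hv
  by_contra hvE
  exact h E hE hn ⟨v, by simp [hv, hvE]⟩ hb

/-- To show that `G[S]` is connected, it suffices to consider sets avoiding a given vertex. -/
theorem connOn_of_avoid {S : Finset V} (a : V) (h : ∀ E ⊆ S, E.Nonempty → (S \ E).Nonempty →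
    a ∉ E → G.NbrsWithin S E ∅ → False) : G.ConnOn S := by
  refine connOn_of_forall fun E hE hn hn' hb => ?_
  by_cases ha : a ∈ E
  · exact h (S \ E) Finset.sdiff_subset hn' (by simpa [Finset.inter_eq_right.2 hE] using hn)
      (by simp [ha]) (hb.compl)
  · exact h E hE hn hn' ha hb

/-- Three disjoint ends of a connected graph are pairwise non-adjacent. -/
theorem ConnOn.not_adj_ends {S E₁ E₂ E₃ : Finset V} (hS : G.ConnOn S) (h₁ : G.IsEnd S E₁)
    (h₂ : G.IsEnd S E₂) (h₃ : E₃ ⊆ S) (hn : E₃.Nonempty) (d12 : Disjoint E₁ E₂)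
    (d13 : Disjoint E₁ E₃) (d23 : Disjoint E₂ E₃) {a b : V} (ha : a ∈ E₁)
    (hb : b ∈ E₂) (hab : G.Adj a b) : False := by
  have := hS.subset_union h₁ h₂ d12 ha hb hab
  obtain ⟨c, hc⟩ := hn
  have := this (h₃ hc)
  rw [Finset.disjoint_left] at d13 d23
  grind

/-! ### Deleting a vertex -/

theorem BiconnOn.connOn_erase {S : Finset V} (h : G.BiconnOn S) {y : V} :
    G.ConnOn (S.erase y) := by
  intro E hE hn hb v hv
  have := h E (hE.trans (Finset.erase_subset _ _)) hn y (fun e he w hw hew => by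
    by_cases hwy : w = y
    · simp [hwy]
    · simpa [hwy] using hb e he w (by simp [hw, hwy]) hew)
  have := this (Finset.mem_of_mem_erase hv)
  grind

/-- Each of three disjoint ends would contain a neighbour of `y`, or it would be cut off in `S` by
one vertex. Claw-freeness at `y` then makes two of the ends adjacent. -/
theorem BiconnOn.chainOn_erase {S : Finset V} (hcf : G.NoClaw) (h : G.BiconnOn S) (y : V) :
    G.ChainOn (S.erase y) := by
  have hc := h.connOn_erase (y := y)
  refine ⟨hc, fun E₁ E₂ E₃ h₁ h₂ h₃ d12 d13 d23 => ?_⟩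
  have key : ∀ E E' E'', G.IsEnd (S.erase y) E → G.IsEnd (S.erase y) E' →
      G.IsEnd (S.erase y) E'' → Disjoint E E' → Disjoint E E'' → Disjoint E' E'' →
      ∃ e ∈ E, G.Adj y e := by
    rintro E E' E'' ⟨s, n, u, hu⟩ ⟨s', ⟨x', hx'⟩, -⟩ ⟨s'', ⟨x'', hx''⟩, -⟩ d d' d''
    by_contra! hcon
    have := h E (s.trans (Finset.erase_subset _ _)) n u (fun e he w hw hew => by
      by_cases hwy : w = y
      · subst hwy; exact absurd hew.symm (hcon e he)
      · exact hu e he w (by simp [hw, hwy]) hew)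
    have a1 := this (Finset.mem_of_mem_erase (s' hx'))
    have a2 := this (Finset.mem_of_mem_erase (s'' hx''))
    rw [Finset.disjoint_left] at d d' d''
    grind
  obtain ⟨e₁, he₁, ha₁⟩ := key E₁ E₂ E₃ h₁ h₂ h₃ d12 d13 d23
  obtain ⟨e₂, he₂, ha₂⟩ := key E₂ E₁ E₃ h₂ h₁ h₃ d12.symm d23 d13
  obtain ⟨e₃, he₃, ha₃⟩ := key E₃ E₁ E₂ h₃ h₁ h₂ d13.symm d23.symm d12
  rcases hcf y e₁ e₂ e₃ ha₁ ha₂ ha₃ (by rintro rfl; exact Finset.disjoint_left.1 d12 he₁ he₂)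
    (by rintro rfl; exact Finset.disjoint_left.1 d13 he₁ he₃)
    (by rintro rfl; exact Finset.disjoint_left.1 d23 he₂ he₃) with h' | h' | h'
  · exact hc.not_adj_ends h₁ h₂ h₃.1 h₃.2.1 d12 d13 d23 he₁ he₂ h'
  · exact hc.not_adj_ends h₁ h₃ h₂.1 h₂.2.1 d13 d12 d23.symm he₁ he₃ h'
  · exact hc.not_adj_ends h₂ h₃ h₁.1 h₁.2.1 d23 d12.symm d13.symm he₂ he₃ h'

/-- Of three disjoint ends at most one contains a neighbour of `x`. That one stays an end after
absorbing `x`, because every other neighbour of `x` is adjacent to one of its vertices; the others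
are ends of `S` already. -/
theorem ChainOn.erase_of_cliqueNbrs {S : Finset V} (h : G.ChainOn S) {x : V} (hxS : x ∈ S)
    (hx : G.CliqueNbrs S x) : G.ChainOn (S.erase x) := by
  have hc : G.ConnOn (S.erase x) := by
    refine connOn_of_forall fun E hE hn hn' hb => ?_
    have hx' : ∀ E ⊆ S.erase x, E.Nonempty → G.NbrsWithin (S.erase x) E ∅ →
        ∃ e ∈ E, G.Adj x e := by
      intro E hE hn hb
      by_contra! hcon
      have := h.1 E (hE.trans (Finset.erase_subset _ _)) hn (fun e he w hw hew => by
        by_cases hwx : w = x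
        · subst hwx; exact absurd hew.symm (hcon e he)
        · exact hb e he w (by simp [hw, hwx]) hew)
      have := hE (this hxS)
      simp at this
    obtain ⟨e, he, hxe⟩ := hx' E hE hn hb
    obtain ⟨f, hf, hxf⟩ := hx' _ Finset.sdiff_subset hn' (hb.compl)
    have := hx e (Finset.mem_of_mem_erase (hE he)) f (by grind) hxe hxf (by grind)
    have := hb e he f (by grind) this
    grind
  refine ⟨hc, fun E₁ E₂ E₃ h₁ h₂ h₃ d12 d13 d23 => ?_⟩
  have hx' := hx.mono (Finset.erase_subset x S)
  have lift0 : ∀ E, G.IsEnd (S.erase x) E → (∀ e ∈ E, ¬ G.Adj x e) → G.IsEnd S E := by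
    rintro E ⟨s, n, u, hu⟩ hne
    refine ⟨s.trans (Finset.erase_subset _ _), n, u, fun e he w hw hew => ?_⟩
    by_cases hwx : w = x
    · subst hwx; exact absurd hew.symm (hne e he)
    · exact hu e he w (by simp [hw, hwx]) hew
  have lift1 : ∀ E, G.IsEnd (S.erase x) E → (∃ e ∈ E, G.Adj x e) → G.IsEnd S (insert x E) := by
    rintro E ⟨s, n, u, hu⟩ ⟨e', he', hxe'⟩
    refine ⟨by grind, by simp, u, fun e he w hw hew => ?_⟩
    by_cases hwx : w = x
    · simp [hwx]
    · rcases Finset.mem_insert.1 he with rfl | he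
      · by_cases hwe : w = e'
        · simp [hwe, he']
        · have := hu e' he' w (by simp [hw, hwx])
            (hx e' (by grind) w hw hxe' hew (Ne.symm hwe))
          grind
      · have := hu e he w (by simp [hw, hwx]) hew
        grind
  have main : ∀ E₁ E₂ E₃, G.IsEnd (S.erase x) E₁ → G.IsEnd (S.erase x) E₂ →
      G.IsEnd (S.erase x) E₃ → Disjoint E₁ E₂ → Disjoint E₁ E₃ → Disjoint E₂ E₃ →
      (∃ e ∈ E₁, G.Adj x e) → False := by
    intro E₁ E₂ E₃ h₁ h₂ h₃ d12 d13 d23 ⟨e, he, hxe⟩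
    refine h.2 (insert x E₁) E₂ E₃ (lift1 _ h₁ ⟨e, he, hxe⟩) (lift0 _ h₂ ?_) (lift0 _ h₃ ?_)
      (Finset.disjoint_insert_left.2 ⟨fun hx2 => ?_, d12⟩)
      (Finset.disjoint_insert_left.2 ⟨fun hx3 => ?_, d13⟩) d23
    · intro f hf hxf
      exact hc.not_two_ends h₁ h₂ h₃.1 h₃.2.1 d12 d13 d23 hx' he hf hxe hxf
    · intro f hf hxf
      exact hc.not_two_ends h₁ h₃ h₂.1 h₂.2.1 d13 d12 d23.symm hx' he hf hxe hxf
    · simpa using h₂.1 hx2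
    · simpa using h₃.1 hx3
  by_cases c1 : ∃ e ∈ E₁, G.Adj x e
  · exact main E₁ E₂ E₃ h₁ h₂ h₃ d12 d13 d23 c1
  by_cases c2 : ∃ e ∈ E₂, G.Adj x e
  · exact main E₂ E₁ E₃ h₂ h₁ h₃ d12.symm d23 d13 c2
  by_cases c3 : ∃ e ∈ E₃, G.Adj x e
  · exact main E₃ E₁ E₂ h₃ h₁ h₂ d13.symm d23.symm d12 c3
  push Not at c1 c2 c3
  exact h.2 _ _ _ (lift0 _ h₁ c1) (lift0 _ h₂ c2) (lift0 _ h₃ c3) d12 d13 d23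

/-- A part attached by `u` either misses the neighbours of `x` or can absorb `x`, and is then
attached by `u` in `S`. -/
theorem BiconnOn.erase_of_cliqueNbrs {S : Finset V} (h : G.BiconnOn S) {x : V}
    (hx : G.CliqueNbrs S x) : G.BiconnOn (S.erase x) := by
  intro E hE hn u hu
  by_cases hc : ∃ e ∈ E, G.Adj x e
  · obtain ⟨e', he', hxe'⟩ := hc
    by_cases hxS : x ∈ S
    · have := h (insert x E) (by grind) (by simp) u (fun e he w hw hew => by
        by_cases hwx : w = x
        · simp [hwx]
        · rcases Finset.mem_insert.1 he with rfl | he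
          · by_cases hwe : w = e'
            · simp [hwe, he']
            · have := hu e' he' w (by simp [hw, hwx])
                (hx e' (by grind) w hw hxe' hew (Ne.symm hwe))
              grind
          · have := hu e he w (by simp [hw, hwx]) hew
            grind)
      grind
    · rw [Finset.erase_eq_of_notMem hxS] at hu hE ⊢
      exact h E hE hn u hu
  · push Not at hc
    have := h E (hE.trans (Finset.erase_subset _ _)) hn u (fun e he w hw hew => by
      by_cases hwx : w = x
      · subst hwx; exact absurd hew.symm (hc e he)
      · exact hu e he w (by simp [hw, hwx]) hew)
    exact (Finset.erase_subset _ _).trans this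

/-! ### Separations and the sides of a cut vertex -/

/-- `S` is the disjoint union of `C`, `T`, `R`, with `C` and `R` nonempty and no edges between
`C` and `R`. -/
structure IsSep (G : SimpleGraph V) (S C T R : Finset V) : Prop where
  mem : ∀ v, v ∈ S ↔ v ∈ C ∨ v ∈ T ∨ v ∈ R
  notMem_left : ∀ v ∈ C, v ∉ T
  notMem_right : ∀ v ∈ R, v ∉ T
  disj : ∀ v ∈ C, v ∉ R
  not_adj : ∀ c ∈ C, ∀ r ∈ R, ¬ G.Adj c r
  nonempty_left : C.Nonempty
  nonempty_right : R.Nonempty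

theorem IsSep.symm {S C T R : Finset V} (h : G.IsSep S C T R) : G.IsSep S R T C where
  mem v := by rw [h.mem]; tauto
  notMem_left := h.notMem_right
  notMem_right := h.notMem_left
  disj v hv hv' := h.disj v hv' hv
  not_adj r hr c hc hrc := h.not_adj c hc r hr hrc.symm
  nonempty_left := h.nonempty_right
  nonempty_right := h.nonempty_left

theorem IsSep.nbrsWithin {S C T R : Finset V} (h : G.IsSep S C T R) : G.NbrsWithin S C T := by
  intro e he v hv hev
  have := h.not_adj e he v
  have := (h.mem v).1 hv
  tauto

theorem IsSep.left_subset {S C T R : Finset V} (h : G.IsSep S C T R) : C ⊆ S :=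
  fun v hv => (h.mem v).2 (.inl hv)

theorem IsSep.middle_subset {S C T R : Finset V} (h : G.IsSep S C T R) : T ⊆ S :=
  fun v hv => (h.mem v).2 (.inr (.inl hv))

theorem IsSep.card {S C T R : Finset V} (h : G.IsSep S C T R) :
    S.card = C.card + T.card + R.card := by
  have : S = (C ∪ T) ∪ R := by ext v; rw [h.mem]; simp
  rw [this, Finset.card_union_of_disjoint, Finset.card_union_of_disjoint]
  · exact Finset.disjoint_left.2 h.notMem_left
  · refine Finset.disjoint_left.2 fun v hv hr => ?_
    have := h.disj v
    have := h.notMem_right v hr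
    grind

theorem isSep_of_nbrsWithin {S C T : Finset V} (hC : C ⊆ S) (hT : T ⊆ S) (hCT : Disjoint C T)
    (hn : C.Nonempty) (hn' : ¬ S ⊆ C ∪ T) (h : G.NbrsWithin S C T) :
    G.IsSep S C T (S \ (C ∪ T)) where
  mem v := by grind
  notMem_left := fun v hv => Finset.disjoint_left.1 hCT hv
  notMem_right := by grind
  disj := by grind
  not_adj c hc r hr hcr := by
    have := h c hc r (by grind) hcr
    grind
  nonempty_left := hn
  nonempty_right := Finset.sdiff_nonempty.2 hn'

theorem IsSep.exists_adj_of_connOn {S L R : Finset V} {x : V} (hS : G.ConnOn S)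
    (h : G.IsSep S L {x} R) : ∃ l ∈ L, G.Adj x l := by
  by_contra! hcon
  have := hS L h.left_subset h.nonempty_left (fun e he v hv hev => by
    have := h.nbrsWithin e he v hv hev
    have := hcon e he
    have := hev.symm
    grind)
  have hx := this ((h.mem x).2 (by simp))
  exact h.notMem_left x hx (by simp)

/-- Two non-adjacent neighbours in `L` and one in `R` would form a claw at `x`. -/
theorem IsSep.cliqueNbrs {S L T R : Finset V} {x : V} (hcf : G.NoClaw)
    (h : G.IsSep S L T R) (hr : ∃ r ∈ R, G.Adj x r) : G.CliqueNbrs L x := by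
  obtain ⟨r, hr, hxr⟩ := hr
  intro u hu v hv hxu hxv huv
  rcases hcf x u v r hxu hxv hxr huv (fun e => h.disj u hu (e ▸ hr))
    (fun e => h.disj v hv (e ▸ hr)) with h' | h' | h'
  · exact h'
  · exact absurd h' (h.not_adj u hu r hr)
  · exact absurd h' (h.not_adj v hv r hr)

/-- An end containing `x` becomes an end of `S` by adding `R`; an end avoiding `x` is one already.
-/
theorem IsSep.chainOn_insert {S L R : Finset V} {x : V} (hS : G.ChainOn S)
    (h : G.IsSep S L {x} R) : G.ChainOn (insert x L) := by
  have hsub : insert x L ⊆ S := by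
    have := h.left_subset
    have := h.middle_subset
    grind
  have lift0 : ∀ E ⊆ insert x L, x ∉ E → ∀ T, G.NbrsWithin (insert x L) E T →
      G.NbrsWithin S E T := by
    intro E hE hx T hb e he v hv hev
    have := hb e he v
    have := h.nbrsWithin e (by grind) v hv hev
    grind
  constructor
  · refine connOn_of_avoid x fun E hE hn hn' hx hb => ?_
    have := hS.1 E (hE.trans hsub) hn (lift0 E hE hx ∅ hb)
    grind
  · intro E₁ E₂ E₃ h₁ h₂ h₃ d12 d13 d23
    have l0 : ∀ E, G.IsEnd (insert x L) E → x ∉ E → G.IsEnd S E := by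
      rintro E ⟨s, n, u, hu⟩ hx
      exact ⟨s.trans hsub, n, u, lift0 E s hx _ hu⟩
    have l1 : ∀ E, G.IsEnd (insert x L) E → x ∈ E → G.IsEnd S (E ∪ R) := by
      rintro E ⟨s, n, u, hu⟩ hx
      refine ⟨Finset.union_subset (s.trans hsub) h.symm.left_subset, by simp [n], u,
        fun e he v hv hev => ?_⟩
      have := (h.mem v).1 hv
      have := hu e
      have := h.symm.nbrsWithin e
      grind
    have dj : ∀ E ⊆ insert x L, x ∉ E → Disjoint R E := by
      intro E hE hx
      rw [Finset.disjoint_left]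
      intro v hv hv'
      have := h.disj v
      grind
    have main : ∀ E₁ E₂ E₃, G.IsEnd (insert x L) E₁ → G.IsEnd (insert x L) E₂ →
        G.IsEnd (insert x L) E₃ → Disjoint E₁ E₂ → Disjoint E₁ E₃ → Disjoint E₂ E₃ →
        x ∈ E₁ → False := by
      intro E₁ E₂ E₃ h₁ h₂ h₃ d12 d13 d23 hx
      have n2 := Finset.disjoint_left.1 d12 hx
      have n3 := Finset.disjoint_left.1 d13 hx
      exact hS.2 _ _ _ (l1 _ h₁ hx) (l0 _ h₂ n2) (l0 _ h₃ n3)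
        (Finset.disjoint_union_left.2 ⟨d12, dj _ h₂.1 n2⟩)
        (Finset.disjoint_union_left.2 ⟨d13, dj _ h₃.1 n3⟩) d23
    by_cases c1 : x ∈ E₁
    · exact main E₁ E₂ E₃ h₁ h₂ h₃ d12 d13 d23 c1
    by_cases c2 : x ∈ E₂
    · exact main E₂ E₁ E₃ h₂ h₁ h₃ d12.symm d23 d13 c2
    by_cases c3 : x ∈ E₃
    · exact main E₃ E₁ E₂ h₃ h₁ h₂ d13.symm d23.symm d12 c3
    exact hS.2 _ _ _ (l0 _ h₁ c1) (l0 _ h₂ c2) (l0 _ h₃ c3) d12 d13 d23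

theorem IsSep.chainOn_left {S L R : Finset V} {x : V} (hcf : G.NoClaw) (hS : G.ChainOn S)
    (h : G.IsSep S L {x} R) : G.ChainOn L := by
  have hx : x ∉ L := fun hx => h.notMem_left x hx (by simp)
  have h1 := h.chainOn_insert hS
  have h2 := h1.erase_of_cliqueNbrs (x := x) (by simp) (by
    have := h.cliqueNbrs hcf (h.symm.exists_adj_of_connOn hS.1)
    intro u hu v hv hxu hxv
    exact this u (Finset.mem_of_mem_insert_of_ne hu hxu.ne') v
      (Finset.mem_of_mem_insert_of_ne hv hxv.ne') hxu hxv)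
  rwa [Finset.erase_insert hx] at h2

/-- Here `r` stands in for all of `R`: an end meeting the edge `xr` becomes an end of `S` by adding
`R`, and of three disjoint ends at most one meets that edge. -/
theorem IsSep.chainOn_insert_leaf {S L R : Finset V} {x r : V} (hS : G.ChainOn S)
    (h : G.IsSep S L {x} R) (hr : r ∈ R) (hxr : G.Adj x r) :
    G.ChainOn (insert r (insert x L)) := by
  have hLS := h.left_subset
  have hRS := h.symm.left_subset
  have hxS := h.middle_subset
  have hc : G.ConnOn (insert r (insert x L)) := by
    refine connOn_of_avoid x fun E hE hn hn' hx hb => ?_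
    have hrE : r ∉ E := fun hrE => by
      have := hb r hrE x (by simp) hxr.symm
      grind
    have := hS.1 E (by grind) hn (fun e he v hv hev => by
      have := hb e he v
      have := h.nbrsWithin e (by grind) v hv hev
      grind)
    grind
  refine ⟨hc, fun E₁ E₂ E₃ h₁ h₂ h₃ d12 d13 d23 => ?_⟩
  have l0 : ∀ E, G.IsEnd (insert r (insert x L)) E → ¬ (x ∈ E ∨ r ∈ E) → G.IsEnd S E := by
    rintro E ⟨s, n, u, hu⟩ hx
    refine ⟨by grind, n, u, fun e he v hv hev => ?_⟩
    have := hu e he v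
    have := h.nbrsWithin e (by grind) v hv hev
    grind
  have l1 : ∀ E, G.IsEnd (insert r (insert x L)) E → (x ∈ E ∨ r ∈ E) → G.IsEnd S (E ∪ R) := by
    rintro E ⟨s, n, u, hu⟩ hx
    have hxu : x ∈ E ∨ x = u := by
      by_cases hxE : x ∈ E
      · exact .inl hxE
      · have := hu r (by tauto) x (by simp) hxr.symm
        grind
    refine ⟨by grind, by simp [n], u, fun e he v hv hev => ?_⟩
    have := (h.mem v).1 hv
    have := hu e
    have := h.symm.nbrsWithin e
    grind
  have dj : ∀ E ⊆ insert r (insert x L), r ∉ E → Disjoint R E := by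
    intro E hE hrE
    rw [Finset.disjoint_left]
    intro v hv hv'
    have := h.disj v
    have := h.notMem_right v hv
    grind
  have main : ∀ E₁ E₂ E₃, G.IsEnd (insert r (insert x L)) E₁ →
      G.IsEnd (insert r (insert x L)) E₂ →
      G.IsEnd (insert r (insert x L)) E₃ → Disjoint E₁ E₂ → Disjoint E₁ E₃ → Disjoint E₂ E₃ →
      (x ∈ E₁ ∨ r ∈ E₁) → False := by
    intro E₁ E₂ E₃ h₁ h₂ h₃ d12 d13 d23 hx
    have aux : ∀ E E', G.IsEnd (insert r (insert x L)) E → G.IsEnd (insert r (insert x L)) E' →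
        Disjoint E₁ E → Disjoint E₁ E' → Disjoint E E' → ¬ (x ∈ E ∨ r ∈ E) := by
      intro E E' h h' d d' d'' hE
      have := Finset.disjoint_left.1 d
      rcases hx with hx | hx <;> rcases hE with hE | hE
      · grind
      · exact hc.not_adj_ends h₁ h h'.1 h'.2.1 d d' d'' hx hE hxr
      · exact hc.not_adj_ends h₁ h h'.1 h'.2.1 d d' d'' hx hE hxr.symm
      · grind
    have n2 := aux E₂ E₃ h₂ h₃ d12 d13 d23
    have n3 := aux E₃ E₂ h₃ h₂ d13 d12 d23.symm
    exact hS.2 _ _ _ (l1 _ h₁ hx) (l0 _ h₂ n2) (l0 _ h₃ n3)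
      (Finset.disjoint_union_left.2 ⟨d12, dj _ h₂.1 (by tauto)⟩)
      (Finset.disjoint_union_left.2 ⟨d13, dj _ h₃.1 (by tauto)⟩) d23
  by_cases c1 : x ∈ E₁ ∨ r ∈ E₁
  · exact main E₁ E₂ E₃ h₁ h₂ h₃ d12 d13 d23 c1
  by_cases c2 : x ∈ E₂ ∨ r ∈ E₂
  · exact main E₂ E₁ E₃ h₂ h₁ h₃ d12.symm d23 d13 c2
  by_cases c3 : x ∈ E₃ ∨ r ∈ E₃
  · exact main E₃ E₁ E₂ h₃ h₁ h₂ d13.symm d23.symm d12 c3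
  exact hS.2 _ _ _ (l0 _ h₁ c1) (l0 _ h₂ c2) (l0 _ h₃ c3) d12 d13 d23

theorem IsSep.swap {S C R : Finset V} {a b : V} (h : G.IsSep S C {a, b} R) :
    G.IsSep S C {b, a} R := by rwa [Finset.pair_comm]

theorem IsSep.exists_adj_of_biconnOn {S C R : Finset V} {a b : V} (hS : G.BiconnOn S)
    (h : G.IsSep S C {a, b} R) (hab : a ≠ b) : ∃ c ∈ C, G.Adj a c := by
  by_contra! hcon
  have := hS C h.left_subset h.nonempty_left b (fun e he v hv hev => by
    have := h.nbrsWithin e he v hv hev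
    have := hcon e he
    have := hev.symm
    grind)
  have hx := this ((h.mem a).2 (by simp))
  have := h.notMem_left a
  grind

/-- In a graph without cut vertices, a side of a separation by two vertices contains no end. -/
theorem IsSep.not_end {S C R : Finset V} {a b : V} (hS : G.BiconnOn S)
    (h : G.IsSep S C {a, b} R) (hab : a ≠ b) {E : Finset V} (hE : E ⊆ C) (hn : E.Nonempty) (u : V)
    (hu : G.NbrsWithin S E {u}) : False := by
  have := hS E (hE.trans h.left_subset) hn u hu
  have ha := this ((h.mem a).2 (by simp))
  have hb := this ((h.mem b).2 (by simp))
  have := h.notMem_left a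
  have := h.notMem_left b
  grind

/-- Pigeonhole: three disjoint ends fall into two classes, each of which can hold only one of them.
-/
theorem chainOn_of_conn {S : Finset V} (hc : G.ConnOn S) (P : Finset V → Prop)
    (Q : Finset V → Prop) (hPQ : ∀ E, G.IsEnd S E → P E ∨ Q E)
    (hP : ∀ E E' E'', G.IsEnd S E → G.IsEnd S E' → G.IsEnd S E'' → Disjoint E E' →
      Disjoint E E'' → Disjoint E' E'' → P E → P E' → False)
    (hQ : ∀ E E' E'', G.IsEnd S E → G.IsEnd S E' → G.IsEnd S E'' → Disjoint E E' →
      Disjoint E E'' → Disjoint E' E'' → Q E → Q E' → False) : G.ChainOn S := by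
  refine ⟨hc, fun E₁ E₂ E₃ h₁ h₂ h₃ d12 d13 d23 => ?_⟩
  have p12 := hP E₁ E₂ E₃ h₁ h₂ h₃ d12 d13 d23
  have p13 := hP E₁ E₃ E₂ h₁ h₃ h₂ d13 d12 d23.symm
  have p23 := hP E₂ E₃ E₁ h₂ h₃ h₁ d23 d12.symm d13.symm
  have q12 := hQ E₁ E₂ E₃ h₁ h₂ h₃ d12 d13 d23
  have q13 := hQ E₁ E₃ E₂ h₁ h₃ h₂ d13 d12 d23.symm
  have q23 := hQ E₂ E₃ E₁ h₂ h₃ h₁ d23 d12.symm d13.symm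
  have := hPQ E₁ h₁
  have := hPQ E₂ h₂
  have := hPQ E₃ h₃
  tauto

/-! ### The sides of a two-vertex cut -/

section TwoCut

variable {S C R : Finset V} {a b : V}

theorem IsSep.chainOn_insert_insert (hS : G.BiconnOn S)
    (h : G.IsSep S C {a, b} R) (hab : a ≠ b) : G.ChainOn (insert a (insert b C)) := by
  have hCS := h.left_subset
  have hTS := h.middle_subset
  have lift : ∀ E ⊆ insert a (insert b C), a ∉ E → b ∉ E → ∀ T,
      G.NbrsWithin (insert a (insert b C)) E T → G.NbrsWithin S E T := by
    intro E hE ha hb T hT e he v hv hev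
    have := hT e he v
    have := h.nbrsWithin e (by grind) v hv hev
    grind
  refine chainOn_of_conn (connOn_of_avoid a fun E hE hn hn' ha hb => ?_) (fun E => a ∈ E)
    (fun E => b ∈ E) ?_ ?_ ?_
  · obtain ⟨c, hc, hac⟩ := h.exists_adj_of_biconnOn hS hab
    have hcE : c ∉ E := fun hcE => by
      have := hb c hcE a (by simp) hac.symm
      grind
    have key : G.NbrsWithin S (E.erase b) {b} := by
      intro e he v hv hev
      have := hb e (by grind) v
      have := h.nbrsWithin e (by grind) v hv hev
      grind
    by_cases hne : (E.erase b).Nonempty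
    · exact h.not_end hS hab (by grind) hne b key
    · have hE' : E = {b} := by
        have := Finset.not_nonempty_iff_eq_empty.1 hne
        have := Finset.erase_eq_empty_iff E b |>.1 this
        rcases this with h | h
        · simp [h] at hn
        · exact h
      obtain ⟨d, hd, hbd⟩ := h.swap.exists_adj_of_biconnOn hS hab.symm
      have := hb b (by simp [hE']) d (by simp [hd]) hbd
      have := h.notMem_left d hd
      grind
  · rintro E ⟨s, n, u, hu⟩
    by_contra! hcon
    exact h.not_end hS hab (by grind) n u (lift E s hcon.1 hcon.2 _ hu)
  · intro E E' E'' _ _ _ d _ _ h1 h2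
    exact Finset.disjoint_left.1 d h1 h2
  · intro E E' E'' _ _ _ d _ _ h1 h2
    exact Finset.disjoint_left.1 d h1 h2

/-- An end avoiding `a` contains a neighbour of `b`. The neighbours of `b` in `C` form a clique, so
two disjoint ends of this kind would be adjacent. -/
theorem IsSep.chainOn_insert_one (hcf : G.NoClaw) (hS : G.BiconnOn S)
    (h : G.IsSep S C {a, b} R) (hab : a ≠ b) : G.ChainOn (insert a C) := by
  have hCS := h.left_subset
  have hTS := h.middle_subset
  have lift : ∀ E ⊆ insert a C, a ∉ E → ∀ u,
      G.NbrsWithin (insert a C) E {u} → (∀ e ∈ E, ¬ G.Adj b e) → G.NbrsWithin S E {u} := by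
    intro E hE ha u hT hbe e he v hv hev
    have := hT e he v
    have := h.nbrsWithin e (by grind) v hv hev
    have := hbe e he
    have := hev.symm
    grind
  have hcl := h.cliqueNbrs hcf (h.symm.swap.exists_adj_of_biconnOn hS hab.symm)
  have hc : G.ConnOn (insert a C) := by
    refine connOn_of_avoid a fun E hE hn hn' ha hb => ?_
    refine h.not_end hS hab (by grind) hn b fun e he v hv hev => ?_
    have := hb e he v
    have := h.nbrsWithin e (by grind) v hv hev
    grind
  refine chainOn_of_conn hc (fun E => a ∈ E) (fun E => a ∉ E ∧ ∃ e ∈ E, G.Adj b e) ?_ ?_ ?_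
  · rintro E ⟨s, n, u, hu⟩
    by_contra! hcon
    exact h.not_end hS hab (by grind) n u (lift E s hcon.1 u hu (hcon.2 hcon.1))
  · intro E E' E'' _ _ _ d _ _ h1 h2
    exact Finset.disjoint_left.1 d h1 h2
  · rintro E E' E'' h1 h2 h3 d d' d'' ⟨ha, e, he, hbe⟩ ⟨ha', e', he', hbe'⟩
    refine hc.not_adj_ends h1 h2 h3.1 h3.2.1 d d' d'' he he'
      (hcl e ?_ e' ?_ hbe hbe' (Finset.disjoint_iff_ne.1 d e he e' he'))
    · have := h1.1 he; grind
    · have := h2.1 he'; grind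

theorem IsSep.connOn_left (hcf : G.NoClaw) (hS : G.BiconnOn S)
    (h : G.IsSep S C {a, b} R) (hab : a ≠ b) : G.ConnOn C := by
  have hCS := h.left_subset
  have hcl := h.cliqueNbrs hcf (h.symm.exists_adj_of_biconnOn hS hab)
  have key : ∀ E ⊆ C, E.Nonempty → G.NbrsWithin C E ∅ → ∃ e ∈ E, G.Adj a e := by
    intro E hE hn hb
    by_contra! hcon
    refine h.not_end hS hab hE hn b fun e he v hv hev => ?_
    have := hb e he v
    have := h.nbrsWithin e (hE he) v hv hev
    have := hcon e he
    have := hev.symm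
    grind
  refine connOn_of_forall fun E hE hn hn' hb => ?_
  obtain ⟨e, he, hae⟩ := key E hE hn hb
  obtain ⟨f, hf, haf⟩ := key _ Finset.sdiff_subset hn' hb.compl
  have := hcl e (hE he) f (by grind) hae haf (by grind)
  have := hb e he f (by grind) this
  grind

/-- An end contains a neighbour of `a` or of `b`, and each of these two cliques meets at most one of
three disjoint ends. -/
theorem IsSep.chainOn_left_of_biconnOn (hcf : G.NoClaw) (hS : G.BiconnOn S)
    (h : G.IsSep S C {a, b} R) (hab : a ≠ b) : G.ChainOn C := by
  have hc := h.connOn_left hcf hS hab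
  have hcla := h.cliqueNbrs hcf (h.symm.exists_adj_of_biconnOn hS hab)
  have hclb := h.cliqueNbrs hcf (h.symm.swap.exists_adj_of_biconnOn hS hab.symm)
  refine chainOn_of_conn hc (fun E => ∃ e ∈ E, G.Adj a e) (fun E => ∃ e ∈ E, G.Adj b e) ?_ ?_ ?_
  · rintro E ⟨s, n, u, hu⟩
    by_contra! hcon
    refine h.not_end hS hab s n u fun e he v hv hev => ?_
    have := hu e he v
    have := h.nbrsWithin e (s he) v hv hev
    have := hcon.1 e he
    have := hcon.2 e he
    have := hev.symm
    grind
  · rintro E E' E'' h1 h2 h3 d d' d'' ⟨e, he, hae⟩ ⟨e', he', hae'⟩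
    exact hc.not_two_ends h1 h2 h3.1 h3.2.1 d d' d'' hcla he he' hae hae'
  · rintro E E' E'' h1 h2 h3 d d' d'' ⟨e, he, hae⟩ ⟨e', he', hae'⟩
    exact hc.not_two_ends h1 h2 h3.1 h3.2.1 d d' d'' hclb he he' hae hae'

end TwoCut

/-! ### Chains with prescribed extremities, and maximal sides -/

/-- `G[S]` is connected and every end contains `s` or `t`. -/
def ChainBetween (G : SimpleGraph V) (S : Finset V) (s t : V) : Prop :=
  G.ConnOn S ∧ ∀ E, G.IsEnd S E → s ∈ E ∨ t ∈ E

/-- Attaching two leaves at the ends of a chain. -/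
theorem ChainBetween.chainOn_insert_insert {X : Finset V} {s t z z' : V}
    (h : G.ChainBetween X s t) (hs : s ∈ X) (ht : t ∈ X)
    (hzs : G.Adj z s) (hzt : G.Adj z' t) :
    G.ChainOn (insert z (insert z' X)) := by
  have hc : G.ConnOn (insert z (insert z' X)) := by
    refine connOn_of_avoid s fun E hE hn hn' hsE hb => ?_
    have hzE : z ∉ E := fun hzE => by
      have := hb z hzE s (by simp [hs]) hzs
      grind
    by_cases hEX : (E ∩ X).Nonempty
    · have := h.1 (E ∩ X) Finset.inter_subset_right hEX (fun e he v hv hev => by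
        have := hb e (by grind) v (by grind) hev
        grind)
      grind
    · have hEz : z' ∈ E := by
        obtain ⟨e, he⟩ := hn
        by_contra hcon
        exact hEX ⟨e, by have := hE he; grind⟩
      have := hb z' hEz t (by simp [ht]) hzt
      exact hEX ⟨t, by grind⟩
  have nadj : ∀ a b E E' E'', G.IsEnd (insert z (insert z' X)) E →
      G.IsEnd (insert z (insert z' X)) E' → G.IsEnd (insert z (insert z' X)) E'' →
      Disjoint E E' → Disjoint E E'' → Disjoint E' E'' → G.Adj a b →
      (a ∈ E ∨ b ∈ E) → (a ∈ E' ∨ b ∈ E') → False := by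
    rintro a b E E' E'' h1 h2 h3 d d' d'' hab (ha | ha) (hb | hb)
    · exact Finset.disjoint_left.1 d ha hb
    · exact hc.not_adj_ends h1 h2 h3.1 h3.2.1 d d' d'' ha hb hab
    · exact hc.not_adj_ends h1 h2 h3.1 h3.2.1 d d' d'' ha hb hab.symm
    · exact Finset.disjoint_left.1 d ha hb
  -- Every end meets the edge `zs` or the edge `z't`. Two disjoint ends meeting the same edge would
  -- be adjacent.
  refine chainOn_of_conn hc (fun E => z ∈ E ∨ s ∈ E) (fun E => z' ∈ E ∨ t ∈ E) ?_ ?_ ?_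
  · rintro E ⟨hE, hn, u, hu⟩
    by_contra! hcon
    have hEX : E ⊆ X := by
      intro e he
      have := hE he
      grind
    have := h.2 E ⟨hEX, hn, u, fun e he v hv hev => hu e he v (by simp [hv]) hev⟩
    tauto
  · intro E E' E'' h1 h2 h3 d d' d''
    exact nadj _ _ E E' E'' h1 h2 h3 d d' d'' hzs
  · intro E E' E'' h1 h2 h3 d d' d''
    exact nadj _ _ E E' E'' h1 h2 h3 d d' d'' hzt

section MaximalSide

variable {S C R : Finset V} {a b s t : V}

/-- `C` is maximal among the sets that avoid `s` and `t`, omit a further vertex,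
and are attached by two vertices. -/
def MaxSide (G : SimpleGraph V) (S C : Finset V) (s t : V) : Prop :=
  ∀ D u v, C ⊂ D → D ⊆ S → s ∉ D → t ∉ D → G.NbrsWithin S D {u, v} →
    ∀ x ∈ S, x ∈ D ∨ x = s ∨ x = t

/-- Let an end avoid `s` and `t`. If it contains one of `a`, `b`, its union with `C` is a larger
side; if both, that union hangs on a single vertex; if neither, the end itself does so in `S`. -/
theorem IsSep.chainBetween_insert_insert (hS : G.BiconnOn S) (h : G.IsSep S C {a, b} R)
    (hab : a ≠ b) (hs : s ∈ R) (ht : t ∈ R) (hst : s ≠ t) (hmax : G.MaxSide S C s t) :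
    G.ChainBetween (insert a (insert b R)) s t := by
  have hRS := h.symm.left_subset
  have hCS := h.left_subset
  have hTS := h.middle_subset
  have hsC := fun hC => h.disj s hC hs
  have htC := fun hC => h.disj t hC ht
  have hsT := h.notMem_right s hs
  have htT := h.notMem_right t ht
  refine ⟨(h.symm.chainOn_insert_insert hS hab).1, ?_⟩
  rintro E ⟨hE, hn, u, hu⟩
  by_contra! hcon
  have one : ∀ a b, G.IsSep S C {a, b} R → E ⊆ insert a (insert b R) →
      G.NbrsWithin (insert a (insert b R)) E {u} → a ∈ E → b ∉ E → False := by
    intro a b h hE hu ha hb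
    have hbR := h.notMem_right b
    have haC := h.notMem_left a
    have hbC := h.notMem_left b
    have hbS := h.middle_subset (show b ∈ ({a, b} : Finset V) by simp)
    have := hmax (C ∪ E) u b
      ⟨Finset.subset_union_left, fun hsub => by
        have := hsub (Finset.mem_union_right C ha); grind⟩
      (by grind) (by grind) (by grind) (fun e he v hv hev => by
        have := (h.mem v).1 hv
        have := hu e
        have := h.nbrsWithin e
        grind) b hbS
    grind
  by_cases ha : a ∈ E <;> by_cases hb : b ∈ E
  · have := hS (C ∪ E) (by grind) (by simp [hn]) u (fun e he v hv hev => by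
        have := (h.mem v).1 hv
        have := hu e
        have := h.nbrsWithin e
        grind)
    have := this (hRS hs)
    have := ‹S ⊆ _› (hRS ht)
    grind
  · exact one a b h hE hu ha hb
  · exact one b a h.swap (by rwa [Finset.insert_comm]) (by rwa [Finset.insert_comm]) hb ha
  · refine h.symm.not_end hS hab (by grind) hn u fun e he v hv hev => ?_
    have := hu e he v
    have := h.symm.nbrsWithin e (by grind) v hv hev
    grind

/-- An offending end that avoids `a` but has a neighbour of `b` joins `C` together with `b`: the
neighbours of `b` in `R` form a clique, so they lie in the end or at its attaching vertex. -/
theorem IsSep.chainBetween_insert (hcf : G.NoClaw) (hS : G.BiconnOn S) (h : G.IsSep S C {a, b} R)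
    (hab : a ≠ b) (hs : s ∈ R) (ht : t ∈ R) (hmax : G.MaxSide S C s t) :
    G.ChainBetween (insert a R) s t := by
  have hRS := h.symm.left_subset
  have hCS := h.left_subset
  have hTS := h.middle_subset
  have hsC := fun hC => h.disj s hC hs
  have htC := fun hC => h.disj t hC ht
  have hsT := h.notMem_right s hs
  have htT := h.notMem_right t ht
  have haC := h.notMem_left a
  have hbC := h.notMem_left b
  have haR := h.notMem_right a
  have hbR := h.notMem_right b
  have haS := hTS (show a ∈ ({a, b} : Finset V) by simp)
  have hbS := hTS (show b ∈ ({a, b} : Finset V) by simp)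
  have hcl := h.symm.cliqueNbrs hcf (h.swap.exists_adj_of_biconnOn hS hab.symm)
  refine ⟨(h.symm.chainOn_insert_one hcf hS hab).1, ?_⟩
  rintro E ⟨hE, hn, u, hu⟩
  by_contra! hcon
  by_cases ha : a ∈ E
  · have := hmax (C ∪ E) u b
      ⟨Finset.subset_union_left, fun hsub => by
        have := hsub (Finset.mem_union_right C ha); grind⟩
      (by grind) (by grind) (by grind) (fun e he v hv hev => by
        have := (h.mem v).1 hv
        have := hu e
        have := h.nbrsWithin e
        grind) b hbS
    grind
  have hER : E ⊆ R := by grind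
  by_cases hb : ∃ e ∈ E, G.Adj b e
  · obtain ⟨f, hf, hbf⟩ := hb
    have := hmax (insert b (C ∪ E)) a u
      ⟨by grind, fun hsub => by have := hsub (Finset.mem_insert_self b _); grind⟩
      (by grind) (by grind) (by grind) (fun e he v hv hev => by
        have := (h.mem v).1 hv
        have := hu e
        have := h.nbrsWithin e
        have := hcl f (hER hf) v
        have := hu f hf v
        grind) a haS
    grind
  · push Not at hb
    refine h.symm.not_end hS hab hER hn u fun e he v hv hev => ?_
    have := hu e he v
    have := h.symm.nbrsWithin e (hER he) v hv hev
    have := hb e he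
    have := hev.symm
    grind

/-- The cut vertices with a neighbour in the offending end are absorbed with it: one of them gives a
side larger than `C`, both give a set attached by one vertex. -/
theorem IsSep.chainBetween_right (hcf : G.NoClaw) (hS : G.BiconnOn S) (h : G.IsSep S C {a, b} R)
    (hab : a ≠ b) (hs : s ∈ R) (ht : t ∈ R) (hst : s ≠ t) (hmax : G.MaxSide S C s t) :
    G.ChainBetween R s t := by
  have hRS := h.symm.left_subset
  have hCS := h.left_subset
  have hTS := h.middle_subset
  have hsC := fun hC => h.disj s hC hs
  have htC := fun hC => h.disj t hC ht
  have hsT := h.notMem_right s hs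
  have htT := h.notMem_right t ht
  refine ⟨h.symm.connOn_left hcf hS hab, ?_⟩
  rintro E ⟨hE, hn, u, hu⟩
  by_contra! hcon
  have one : ∀ a b, a ≠ b → G.IsSep S C {a, b} R → (∃ e ∈ E, G.Adj b e) →
      (∀ e ∈ E, ¬ G.Adj a e) → False := by
    intro a b hab h ⟨f, hf, hbf⟩ ha
    have haC := h.notMem_left a
    have hbC := h.notMem_left b
    have haR := h.notMem_right a
    have hbR := h.notMem_right b
    have haS := h.middle_subset (show a ∈ ({a, b} : Finset V) by simp)
    have hbS := h.middle_subset (show b ∈ ({a, b} : Finset V) by simp)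
    have hcl := h.symm.cliqueNbrs hcf (h.swap.exists_adj_of_biconnOn hS hab.symm)
    have := hmax (insert b (C ∪ E)) a u
      ⟨by grind, fun hsub => by have := hsub (Finset.mem_insert_self b _); grind⟩
      (by grind) (by grind) (by grind) (fun e he v hv hev => by
        have := (h.mem v).1 hv
        have := hu e
        have := h.nbrsWithin e
        have := hcl f (hE hf) v
        have := hu f hf v
        grind) a haS
    grind
  by_cases ha : ∃ e ∈ E, G.Adj a e <;> by_cases hb : ∃ e ∈ E, G.Adj b e
  · obtain ⟨f, hf, haf⟩ := ha
    obtain ⟨g, hg, hbg⟩ := hb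
    have hcla := h.symm.cliqueNbrs hcf (h.exists_adj_of_biconnOn hS hab)
    have hclb := h.symm.cliqueNbrs hcf (h.swap.exists_adj_of_biconnOn hS hab.symm)
    have := hS (insert a (insert b (C ∪ E))) (by grind) (by simp) u (fun e he v hv hev => by
        have h1 := (h.mem v).1 hv
        have h2 := hu e
        have h3 := h.nbrsWithin e
        have h4 := hcla f (hE hf) v
        have h5 := hu f hf v
        have h6 := hclb g (hE hg) v
        have h7 := hu g hg v
        simp only [Finset.mem_insert, Finset.mem_union, Finset.mem_singleton] at *
        rcases he with rfl | rfl | he | he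
        · grind
        · grind
        · grind
        · grind)
    have h1 := this (hRS hs)
    have h2 := this (hRS ht)
    grind
  · push Not at hb
    exact one b a hab.symm h.swap ha hb
  · push Not at ha
    exact one a b hab h hb ha
  · push Not at ha hb
    refine h.symm.not_end hS hab hE hn u fun e he v hv hev => ?_
    have := hu e he v
    have := h.symm.nbrsWithin e (hE he) v hv hev
    have := ha e he
    have := hb e he
    have := hev.symm
    grind

end MaximalSide

/-- Attaching a leaf to a connected graph without two disjoint ends elsewhere. -/
theorem ConnOn.chainOn_insert {X : Finset V} {t z : V} (hc : G.ConnOn X) (ht : t ∈ X)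
    (hzt : G.Adj z t)
    (h : ∀ E E', G.IsEnd X E → G.IsEnd X E' → Disjoint E E' → t ∉ E → t ∉ E' → False) :
    G.ChainOn (insert z X) := by
  have hc' : G.ConnOn (insert z X) := by
    refine connOn_of_avoid t fun E hE hn hn' htE hb => ?_
    have hzE : z ∉ E := fun hzE => by
      have := hb z hzE t (by simp [ht]) hzt
      grind
    have := hc E (by grind) hn (fun e he v hv hev => hb e he v (by simp [hv]) hev)
    grind
  have low : ∀ E, G.IsEnd (insert z X) E → ¬ (z ∈ E ∨ t ∈ E) → G.IsEnd X E ∧ t ∉ E := by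
    rintro E ⟨hE, hn, u, hu⟩ hcon
    exact ⟨⟨by grind, hn, u, fun e he v hv hev => hu e he v (by simp [hv]) hev⟩, by tauto⟩
  refine chainOn_of_conn hc' (fun E => z ∈ E ∨ t ∈ E) (fun E => ¬ (z ∈ E ∨ t ∈ E))
    (fun E _ => em _) ?_ ?_
  · rintro E E' E'' h1 h2 h3 d d' d'' (ha | ha) (hb | hb)
    · exact Finset.disjoint_left.1 d ha hb
    · exact hc'.not_adj_ends h1 h2 h3.1 h3.2.1 d d' d'' ha hb hzt
    · exact hc'.not_adj_ends h1 h2 h3.1 h3.2.1 d d' d'' ha hb hzt.symm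
    · exact Finset.disjoint_left.1 d ha hb
  · intro E E' E'' h1 h2 h3 d d' d'' hE hE'
    obtain ⟨l1, t1⟩ := low E h1 hE
    obtain ⟨l2, t2⟩ := low E' h2 hE'
    exact h E E' l1 l2 d t1 t2

/-! ### Inductive step across a cut -/

/-- Every chain smaller than `S` of size divisible by three has a partition into paths. -/
def PartitionsBelow (G : SimpleGraph V) (S : Finset V) : Prop :=
  ∀ T : Finset V, T.card < S.card → G.ChainOn T → 3 ∣ T.card → G.LambdaPartition T

theorem IsSep.lambdaPartition_of_biconnOn {S C R : Finset V} {a b : V} (hcf : G.NoClaw)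
    (hS : G.BiconnOn S) (h : G.IsSep S C {a, b} R) (hab : a ≠ b) (ih : G.PartitionsBelow S)
    (hdiv : 3 ∣ S.card) : G.LambdaPartition S := by
  have hcard := h.card
  rw [Finset.card_pair hab] at hcard
  have hCn := h.nonempty_left.card_pos
  have hRn := h.nonempty_right.card_pos
  have haC := h.notMem_left a
  have hbC := h.notMem_left b
  have haR := h.notMem_right a
  have hbR := h.notMem_right b
  have main : ∀ C R, G.IsSep S C {a, b} R → C.card + 2 + R.card = S.card → 0 < C.card →
      0 < R.card → a ∉ C → b ∉ C → a ∉ R → b ∉ R → 3 ∣ C.card → G.LambdaPartition S := by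
    intro C R h hc hC hR haC hbC haR hbR h3
    have c2 : (insert a (insert b R)).card = R.card + 2 := by
      rw [Finset.card_insert_of_notMem (by grind), Finset.card_insert_of_notMem hbR]
    have l1 := ih C (by omega) (h.chainOn_left_of_biconnOn hcf hS hab) h3
    have l2 := ih (insert a (insert b R)) (by omega) (h.symm.chainOn_insert_insert hS hab)
      (by omega)
    convert l1.union l2 (by
      rw [Finset.disjoint_left]
      have := h.disj
      grind) using 1
    ext v
    rw [h.mem]
    grind
  by_cases h0 : 3 ∣ C.card
  · exact main C R h (by omega) hCn hRn (by grind) (by grind) (by grind) (by grind) h0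
  by_cases h1 : 3 ∣ R.card
  · exact main R C h.symm (by omega) hRn hCn (by grind) (by grind) (by grind) (by grind) h1
  -- Both sides now have order 2 modulo 3, so each takes one cut vertex.
  have ca : (insert a C).card = C.card + 1 := Finset.card_insert_of_notMem (by grind)
  have cb : (insert b R).card = R.card + 1 := Finset.card_insert_of_notMem (by grind)
  have l1 := ih (insert a C) (by omega) (h.chainOn_insert_one hcf hS hab) (by omega)
  have l2 := ih (insert b R) (by omega) (h.symm.swap.chainOn_insert_one hcf hS hab.symm) (by omega)
  convert l1.union l2 (by
    rw [Finset.disjoint_left]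
    have := h.disj
    grind) using 1
  ext v
  rw [h.mem]
  grind

/-- The induction hypothesis applies to `L` with `x` and a leaf `r` from `R`; the path covering the
leaf is `r x y` with `y ∈ L`. -/
theorem IsSep.exists_adj_partition {S L R : Finset V} {x : V} (hS : G.ChainOn S)
    (h : G.IsSep S L {x} R) (hR : 2 ≤ R.card) (hL : L.card % 3 = 1) (ih : G.PartitionsBelow S) :
    ∃ y ∈ L, G.Adj x y ∧ G.LambdaPartition (L.erase y) := by
  obtain ⟨r, hr, hxr⟩ := h.symm.exists_adj_of_connOn hS.1
  have hcard := h.card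
  have hxL := h.notMem_left x
  have hrL := fun hL => h.disj r hL hr
  have hne := hxr.ne
  have c : (insert r (insert x L)).card = L.card + 2 := by
    rw [Finset.card_insert_of_notMem (by grind), Finset.card_insert_of_notMem (by grind)]
  have hp := ih _ (by simp at hcard; omega) (h.chainOn_insert_leaf hS hr hxr) (by omega)
  obtain ⟨y, hy, hyr, hyx, hxy, hp⟩ := hp.of_leaf (r := r) (x := x) (by simp) (by
    intro v hv hrv
    have := h.not_adj v
    have := hrv.symm
    have := G.irrefl (v := r)
    grind)
  refine ⟨y, by grind, hxy, ?_⟩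
  convert hp using 1
  ext v
  grind

theorem IsSep.lambdaPartition_of_chainOn {S L R : Finset V} {x : V} (hcf : G.NoClaw)
    (hS : G.ChainOn S) (h : G.IsSep S L {x} R) (hL : 2 ≤ L.card) (hR : 2 ≤ R.card)
    (ih : G.PartitionsBelow S) (hdiv : 3 ∣ S.card) : G.LambdaPartition S := by
  have hcard := h.card
  rw [Finset.card_singleton] at hcard
  have main : ∀ L R, G.IsSep S L {x} R → L.card + 1 + R.card = S.card → 2 ≤ L.card →
      2 ≤ R.card → 3 ∣ L.card → G.LambdaPartition S := by
    intro L R h hc hL hR h3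
    have hx := h.notMem_right x
    have hx' := h.notMem_left x
    have c : (insert x R).card = R.card + 1 := Finset.card_insert_of_notMem (by grind)
    have l1 := ih L (by omega) (h.chainOn_left hcf hS) h3
    have l2 := ih (insert x R) (by omega) (h.symm.chainOn_insert hS) (by omega)
    convert l1.union l2 (by
      rw [Finset.disjoint_left]
      have := h.disj
      grind) using 1
    ext v
    rw [h.mem]
    grind
  by_cases h0 : 3 ∣ L.card
  · exact main L R h (by omega) hL hR h0
  by_cases h1 : 3 ∣ R.card
  · exact main R L h.symm (by omega) hR hL h1
  -- Both sides now have order 1 modulo 3: each gives up one neighbour of `x`, and these form a path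
  -- centred at `x`.
  obtain ⟨y, hy, hxy, hp⟩ := h.exists_adj_partition hS hR (by omega) ih
  obtain ⟨y', hy', hxy', hp'⟩ := h.symm.exists_adj_partition hS hL (by omega) ih
  have hx := h.notMem_right x
  have hx' := h.notMem_left x
  have hd := h.disj
  refine LambdaPartition.of_sdiff (x := y) (y := x) (z := y') (h.left_subset hy)
    (h.middle_subset (by simp)) (h.symm.left_subset hy') (by grind) hxy.symm hxy' ?_
  convert hp.union hp' (by
    rw [Finset.disjoint_left]
    grind) using 1
  ext v
  have := h.mem v
  grind

/-! ### Graphs without separating pairs -/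

/-- A graph without separating pairs has an edge whose ends can be deleted leaving
a graph without cut vertices. -/
theorem TriconnOn.exists_contractible {S : Finset V} (hS : G.TriconnOn S) (hcard : 2 ≤ S.card) :
    ∃ a ∈ S, ∃ b ∈ S, G.Adj a b ∧ G.BiconnOn ((S.erase a).erase b) := by
  classical
  by_contra! hcon
  have key : ∀ a ∈ S, ∀ b ∈ S, G.Adj a b → ∃ w E R, G.IsSep S E {a, b, w} R := by
    intro a ha b hb hab
    have := hcon a ha b hb hab
    simp only [BiconnOn] at this
    push Not at this
    obtain ⟨E, hE, hn, u, hu, hnot⟩ := this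
    obtain ⟨f, hf, hfE⟩ := Finset.not_subset.1 hnot
    have hES : E ⊆ S := by grind
    -- Unless `u` is a third vertex outside `E`, the pair `a`, `b` alone separates.
    by_cases hu' : u ∈ S ∧ u ∉ E ∧ u ≠ a ∧ u ≠ b
    · refine ⟨u, E, _, isSep_of_nbrsWithin hES (by grind) ?_ hn ?_ ?_⟩
      · rw [Finset.disjoint_left]; grind
      · intro hsub
        have := hsub (show f ∈ S by grind)
        grind
      · intro e he v hv hev
        have := hu e he v
        grind
    · have := hS E hES hn a b (fun e he v hv hev => by
        have := hu e he v
        grind)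
      grind
  have base : ∃ E, ∃ a b w R, G.Adj a b ∧ G.IsSep S E {a, b, w} R := by
    obtain ⟨a, ha⟩ : S.Nonempty := Finset.card_pos.1 (by omega)
    have : ∃ b ∈ S, G.Adj a b := by
      by_contra! hno
      have := hS {a} (by simpa using ha) (by simp) a a (fun e he v hv hev => by
        have := hno v hv
        grind)
      have := Finset.card_le_card this
      simp at this
      omega
    obtain ⟨b, hb, hab⟩ := this
    obtain ⟨w, E, R, h⟩ := key a ha b hb hab
    exact ⟨E, a, b, w, R, hab, h⟩
  -- A smallest side over all such separations and all edges.
  obtain ⟨E, ⟨a, b, w, R, hab, h⟩, hmin⟩ :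
      ∃ E, (∃ a b w R, G.Adj a b ∧ G.IsSep S E {a, b, w} R) ∧
        ∀ E', (∃ a b w R, G.Adj a b ∧ G.IsSep S E' {a, b, w} R) → E.card ≤ E'.card := by
    have hex : ∃ n, ∃ E : Finset V, E.card = n ∧
      ∃ a b w R, G.Adj a b ∧ G.IsSep S E {a, b, w} R := by
      obtain ⟨E, hE⟩ := base
      exact ⟨_, E, rfl, hE⟩
    obtain ⟨E, hE, hE'⟩ := Nat.find_spec hex
    exact ⟨E, hE', fun E' h' => hE ▸ Nat.find_min' hex ⟨E', rfl, h'⟩⟩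
  have hw : ∃ v ∈ E, G.Adj w v := by
    by_contra! hno
    obtain ⟨r, hr⟩ := h.nonempty_right
    have := hS E h.left_subset h.nonempty_left a b (fun e he v hv hev => by
      have := h.nbrsWithin e he v hv hev
      have := hno e he
      have := hev.symm
      grind)
    have := this (h.symm.left_subset hr)
    have := h.notMem_right r hr
    have := h.disj r
    grind
  obtain ⟨v, hv, hwv⟩ := hw
  obtain ⟨t, E', R', h'⟩ := key w (h.middle_subset (by simp)) v (h.left_subset hv) hwv
  -- Being adjacent, `a` and `b` do not lie on opposite sides, so some side contains neither.
  obtain ⟨X, X', hX, haX, hbX⟩ : ∃ X X', G.IsSep S X {w, v, t} X' ∧ a ∉ X ∧ b ∉ X := by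
    by_cases ha : a ∈ E'
    · exact ⟨R', E', h'.symm, h'.disj a ha, fun hb => h'.not_adj a ha b hb hab⟩
    by_cases hb : b ∈ E'
    · exact ⟨R', E', h'.symm, fun ha => h'.not_adj b hb a ha hab.symm, h'.disj b hb⟩
    exact ⟨E', R', h', ha, hb⟩
  have hq : ∃ q ∈ X, G.Adj v q := by
    by_contra! hno
    obtain ⟨r, hr⟩ := hX.nonempty_right
    have := hS X hX.left_subset hX.nonempty_left w t (fun e he y hy hey => by
      have := hX.nbrsWithin e he y hy hey
      have := hno e he
      have := hey.symm
      grind)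
    have := this (hX.symm.left_subset hr)
    have := hX.notMem_right r hr
    have := hX.disj r
    grind
  obtain ⟨q, hq, hvq⟩ := hq
  have hwX : w ∉ X := fun hwX => hX.notMem_left w hwX (by simp)
  have hvX : v ∉ X := fun hvX => hX.notMem_left v hvX (by simp)
  have hqE : q ∈ E := by
    have := h.nbrsWithin v hv q (hX.left_subset hq) hvq
    grind
  -- As `X` contains none of `a`, `b`, `w`, the set `X ∩ E` is attached only by `{w, v, t}`; it
  -- misses `v ∈ E`, against minimality.
  have := hmin (X ∩ E) ⟨w, v, t, _, hwv, isSep_of_nbrsWithin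
    (Finset.inter_subset_left.trans hX.left_subset) hX.middle_subset (by
      rw [Finset.disjoint_left]
      intro y hy
      exact hX.notMem_left y (Finset.mem_inter.1 hy).1) ⟨q, by simp [hq, hqE]⟩ (by
      obtain ⟨r, hr⟩ := hX.nonempty_right
      intro hsub
      have := hsub (hX.symm.left_subset hr)
      have := hX.notMem_right r hr
      have := hX.disj r
      grind) (by
      intro e he y hy hey
      have := hX.nbrsWithin e (by grind) y hy hey
      have := h.nbrsWithin e (by grind) y hy hey
      grind)⟩
  have := Finset.card_lt_card (show X ∩ E ⊂ E from ⟨Finset.inter_subset_right, fun hsub =>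
    hvX (Finset.mem_inter.1 (hsub hv)).1⟩)
  omega

theorem TriconnOn.lambdaPartition {S : Finset V} (hcf : G.NoClaw) (hS : G.TriconnOn S)
    (hcard : 3 ≤ S.card) (ih : G.PartitionsBelow S) (hdiv : 3 ∣ S.card) :
    G.LambdaPartition S := by
  obtain ⟨a, ha, b, hb, hab, hB⟩ := hS.exists_contractible (by omega)
  have : ∃ c ∈ S, c ≠ b ∧ G.Adj a c := by
    by_contra! hno
    have := hS {a} (by simpa using ha) (by simp) b b (fun e he v hv hev => by
      have := hno v hv
      grind)
    have := Finset.card_le_card this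
    have := Finset.card_le_two (a := b) (b := a)
    simp at *
    omega
  obtain ⟨c, hc, hcb, hac⟩ := this
  have hca := hac.ne'
  have hba := hab.ne'
  have h1 : c ∈ (S.erase a).erase b := by grind
  have h2 := Finset.card_erase_of_mem h1
  have h3 := Finset.card_erase_of_mem (show b ∈ S.erase a by grind)
  have h4 := Finset.card_erase_of_mem ha
  have hp := ih _ (by omega) (hB.chainOn_erase hcf c) (by omega)
  refine LambdaPartition.of_sdiff hc ha hb hcb hac.symm hab ?_
  convert hp using 1
  ext v
  grind

/-! ### Leaves, when cut vertices cut off single vertices -/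

/-- `z` is a leaf of `G[S]` attached to `x`. -/
structure IsLeafAt (G : SimpleGraph V) (S : Finset V) (z x : V) : Prop where
  mem : z ∈ S
  mem_nbr : x ∈ S
  adj : G.Adj z x
  eq_of_adj : ∀ v ∈ S, G.Adj z v → v = x

theorem IsLeafAt.isEnd {S : Finset V} {z x : V} (h : G.IsLeafAt S z x) : G.IsEnd S {z} :=
  ⟨by simpa using h.mem, by simp, x, fun e he v hv hev => by
    have := h.eq_of_adj v hv
    grind⟩

theorem IsLeafAt.cliqueNbrs {S : Finset V} {z x : V} (h : G.IsLeafAt S z x) :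
    G.CliqueNbrs S z := fun u hu v hv hzu hzv huv =>
  absurd ((h.eq_of_adj u hu hzu).trans (h.eq_of_adj v hv hzv).symm) huv

theorem IsLeafAt.erase {S : Finset V} {z x w : V} (h : G.IsLeafAt S z x) (hz : z ≠ w)
    (hx : x ≠ w) : G.IsLeafAt (S.erase w) z x :=
  ⟨by simp [hz, h.mem], by simp [hx, h.mem_nbr], h.adj,
    fun v hv => h.eq_of_adj v (Finset.mem_of_mem_erase hv)⟩

theorem IsLeafAt.isSep {S : Finset V} {z x : V} (h : G.IsLeafAt S z x) (hS : 3 ≤ S.card) :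
    G.IsSep S {z} {x} (S \ ({z} ∪ {x})) := by
  refine isSep_of_nbrsWithin (by simpa using h.mem) (by simpa using h.mem_nbr)
    (by simpa using h.adj.ne) (by simp) (fun hsub => ?_) (fun e he v hv hev => ?_)
  · have := Finset.card_le_card hsub
    have := Finset.card_union_le {z} {x}
    simp at *
    omega
  · have := h.eq_of_adj v hv
    grind

theorem IsLeafAt.cliqueNbrs_erase {S : Finset V} {z x : V} (hcf : G.NoClaw) (h : G.IsLeafAt S z x)
    (hS : 3 ≤ S.card) : G.CliqueNbrs (S.erase z) x := by
  have := (h.isSep hS).symm.cliqueNbrs hcf ⟨z, by simp, h.adj.symm⟩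
  intro u hu v hv hxu hxv huv
  have := hxu.ne
  have := hxv.ne
  exact ‹G.CliqueNbrs _ x› u (by grind) v (by grind) hxu hxv huv

theorem IsSep.exists_isLeafAt {S L R : Finset V} {x : V} (hS : G.ConnOn S)
    (h : G.IsSep S L {x} R) (hL : L.card ≤ 1) : ∃ z, L = {z} ∧ G.IsLeafAt S z x := by
  have hpos := h.nonempty_left.card_pos
  obtain ⟨z, rfl⟩ := Finset.card_eq_one.1 (show L.card = 1 by omega)
  obtain ⟨l, hl, hxl⟩ := h.exists_adj_of_connOn hS
  obtain rfl := Finset.mem_singleton.1 hl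
  refine ⟨l, rfl, h.left_subset hl, h.middle_subset (by simp), hxl.symm, fun v hv hzv => ?_⟩
  have := h.nbrsWithin l hl v hv hzv
  have := hzv.ne
  grind

theorem ConnOn.exists_isSep {S : Finset V} (hS : G.ConnOn S) (hn : ¬ G.BiconnOn S) :
    ∃ E u R, G.IsSep S E {u} R := by
  simp only [BiconnOn] at hn
  push Not at hn
  obtain ⟨E, hE, hn, u, hu, hnot⟩ := hn
  obtain ⟨f, hf, hfE⟩ := Finset.not_subset.1 hnot
  by_cases hu' : u ∈ S ∧ u ∉ E
  · refine ⟨E, u, _, isSep_of_nbrsWithin hE (by simpa using hu'.1) (by simpa using hu'.2) hn ?_ hu⟩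
    intro hsub
    have := hsub hf
    grind
  · have := hS E hE hn (fun e he v hv hev => by
      have := hu e he v hv hev
      grind)
    grind

theorem BiconnOn.exists_isSep {S : Finset V} (hS : G.BiconnOn S) (hn : ¬ G.TriconnOn S) :
    ∃ E u v R, u ≠ v ∧ G.IsSep S E {u, v} R := by
  simp only [TriconnOn] at hn
  push Not at hn
  obtain ⟨E, hE, hn, u, v, hu, hnot⟩ := hn
  obtain ⟨f, hf, hfE⟩ := Finset.not_subset.1 hnot
  by_cases hu' : u ∈ S ∧ u ∉ E ∧ u ≠ v
  · by_cases hv' : v ∈ S ∧ v ∉ E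
    · refine ⟨E, u, v, _, hu'.2.2, isSep_of_nbrsWithin hE (by grind) ?_ hn ?_ hu⟩
      · rw [Finset.disjoint_left]; grind
      · intro hsub
        have := hsub hf
        grind
    · have := hS E hE hn u (fun e he w hw hew => by
        have := hu e he w hw hew
        grind)
      grind
  · have := hS E hE hn v (fun e he w hw hew => by
      have := hu e he w hw hew
      grind)
    grind

/-- A cut vertex always cuts off a single vertex. -/
def OnlyTrivialCuts (G : SimpleGraph V) (S : Finset V) : Prop :=
  ∀ L x R, G.IsSep S L {x} R → L.card ≤ 1 ∨ R.card ≤ 1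

/-- Let `u` separate `S - z`. If `u = x`, then `{z}` and the two sides are three disjoint ends.
Otherwise `u` also cuts off in `S` the side without `x`; the side with `x` and `z` is not trivial,
so the former is a leaf. -/
theorem IsLeafAt.exists_second_leaf {S : Finset V} {z x : V} (hS : G.ChainOn S)
    (hcut : G.OnlyTrivialCuts S) (h : G.IsLeafAt S z x) (hn : ¬ G.BiconnOn (S.erase z)) :
    ∃ z' x', G.IsLeafAt S z' x' ∧ z' ≠ z ∧ z' ≠ x ∧ x' ≠ z ∧ x' ≠ x := by
  obtain ⟨E, u, F, hs⟩ := (hS.erase_of_cliqueNbrs h.mem h.cliqueNbrs).1.exists_isSep hn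
  have hxz := h.adj.ne
  have hzE : z ∉ E := fun hz => by simpa using hs.left_subset hz
  have hzF : z ∉ F := fun hz => by simpa using hs.symm.left_subset hz
  have huz : u ≠ z := by
    have := hs.middle_subset (show u ∈ ({u} : Finset V) by simp)
    grind
  have huE := hs.notMem_left u
  have huF := hs.notMem_right u
  have hd := hs.disj
  have hends : ∀ E F, G.IsSep (S.erase z) E {u} F → z ∉ E → x ∉ E → G.NbrsWithin S E {u} := by
    intro E F hs hzE hxE e he v hv hev
    have := hs.nbrsWithin e he v
    have := h.eq_of_adj e (by have := hs.left_subset he; grind)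
    have := hev.symm
    grind
  by_cases hxu : x = u
  · exfalso
    subst hxu
    refine hS.2 {z} E F h.isEnd
      ⟨hs.left_subset.trans (Finset.erase_subset _ _), hs.nonempty_left, x,
        hends E F hs hzE (by grind)⟩
      ⟨hs.symm.left_subset.trans (Finset.erase_subset _ _), hs.nonempty_right, x,
        hends F E hs.symm hzF (by grind)⟩ ?_ ?_ ?_
    · simpa using hzE
    · simpa using hzF
    · exact Finset.disjoint_left.2 hs.disj
  have main : ∀ E F, G.IsSep (S.erase z) E {u} F → z ∉ E → z ∉ F → x ∈ E →
      ∃ z' x', G.IsLeafAt S z' x' ∧ z' ≠ z ∧ z' ≠ x ∧ x' ≠ z ∧ x' ≠ x := by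
    intro E F hs hzE hzF hx
    have hxF := hs.disj x hx
    have hsep : G.IsSep S F {u} (insert z E) := by
      refine ⟨fun v => ?_, hs.notMem_right, fun v hv => ?_, fun v hv hv' => ?_,
        fun f hf e he hfe => ?_, hs.nonempty_right, by simp⟩
      · have := hs.mem v
        have := h.mem
        grind
      · have := hs.notMem_left v
        grind
      · have := hs.disj v
        grind
      · rcases Finset.mem_insert.1 he with rfl | he
        · have := h.eq_of_adj f (by have := hs.symm.left_subset hf; grind) hfe.symm
          grind
        · exact hs.symm.not_adj f hf e he hfe
    have hcard : (insert z E).card = E.card + 1 := Finset.card_insert_of_notMem hzE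
    have := hs.nonempty_left.card_pos
    obtain ⟨z', rfl, hz'⟩ := hsep.exists_isLeafAt hS.1
      (by rcases hcut _ _ _ hsep with h | h <;> omega)
    exact ⟨z', u, hz', by grind, by grind, huz, Ne.symm hxu⟩
  have hxm := (hs.mem x).1 (by simp [h.mem_nbr, hxz.symm])
  rcases hxm with hx | hx | hx
  · exact main E F hs hzE hzF hx
  · exact absurd (by simpa using hx) hxu
  · exact main F E hs.symm hzF hzE hx

-- Let `u` separate the rest into `E` and `F`. If `x`, `x'` lie on one side, the other side and the
-- two leaves are three ends. If they lie on different sides, `u` is a non-trivial cut of `S`. If `x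
-- = u` and `x' ∈ E`, the ends are `{z}`, `F` and `E` with `z'`; the remaining cases are symmetric.
set_option maxHeartbeats 1000000 in
theorem IsLeafAt.biconnOn_erase_erase {S : Finset V} {z x z' x' : V} (hS : G.ChainOn S)
    (hcut : G.OnlyTrivialCuts S) (h : G.IsLeafAt S z x) (h' : G.IsLeafAt S z' x')
    (h1 : z' ≠ z) (h2 : z' ≠ x) (h3 : x' ≠ z) (h4 : x' ≠ x) :
    G.BiconnOn ((S.erase z).erase z') := by
  have hl' := h'.erase h1 h3
  have hc := ((hS.erase_of_cliqueNbrs h.mem h.cliqueNbrs).erase_of_cliqueNbrs hl'.mem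
    hl'.cliqueNbrs).1
  by_contra hn
  obtain ⟨E, u, F, hs⟩ := hc.exists_isSep hn
  have hxz := h.adj.ne
  have hxz' := h'.adj.ne
  have low : ∀ E F, G.IsSep ((S.erase z).erase z') E {u} F → z ∉ E ∧ z' ∉ E ∧ E ⊆ S := by
    intro E F hs
    have := hs.left_subset
    exact ⟨by grind, by grind, fun v hv => by have := this hv; grind⟩
  have hu : u ∈ S ∧ u ≠ z ∧ u ≠ z' := by
    have := hs.middle_subset (show u ∈ ({u} : Finset V) by simp)
    grind
  have hends : ∀ E F, G.IsSep ((S.erase z).erase z') E {u} F → x ∉ E → x' ∉ E →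
      G.IsEnd S E := by
    intro E F hs hxE hxE'
    obtain ⟨l1, l2, l3⟩ := low E F hs
    refine ⟨l3, hs.nonempty_left, u, fun e he v hv hev => ?_⟩
    have := hs.nbrsWithin e he v
    have := h.eq_of_adj e (l3 he)
    have := h'.eq_of_adj e (l3 he)
    have := hev.symm
    grind
  have same : ∀ E F, G.IsSep ((S.erase z).erase z') E {u} F → x ∉ F → x' ∉ F → False := by
    intro E F hs hx hx'
    obtain ⟨l1, l2, l3⟩ := low F E hs.symm
    exact hS.2 {z} {z'} F h.isEnd h'.isEnd (hends F E hs.symm hx hx') (by simpa using h1.symm)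
      (by simpa using l1) (by simpa using l2)
  have diff : ∀ E F, G.IsSep ((S.erase z).erase z') E {u} F → x ∈ E → x' ∈ F → False := by
    intro E F hs hx hx'
    obtain ⟨l1, l2, l3⟩ := low E F hs
    obtain ⟨k1, k2, k3⟩ := low F E hs.symm
    have hd := hs.disj
    have hsep : G.IsSep S (insert z E) {u} (insert z' F) := by
      refine ⟨fun v => ?_, fun v hv => ?_, fun v hv => ?_, fun v hv hv' => ?_,
        fun e he f hf hef => ?_, by simp, by simp⟩
      · have := hs.mem v
        have := h.mem
        have := h'.mem
        grind
      · have := hs.notMem_left v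
        grind
      · have := hs.notMem_right v
        grind
      · have := hs.disj v
        grind
      · have e1 := h.eq_of_adj f
        have e2 := h'.eq_of_adj e
        have e3 := hef.symm
        have e4 := hs.not_adj e
        have e5 := h'.mem
        have e6 := h.mem
        grind
    have c1 : (insert z E).card = E.card + 1 := Finset.card_insert_of_notMem l1
    have c2 : (insert z' F).card = F.card + 1 := Finset.card_insert_of_notMem k2
    have := hs.nonempty_left.card_pos
    have := hs.nonempty_right.card_pos
    have := hcut _ _ _ hsep
    omega
  have hd := hs.disj
  have hxm := (hs.mem x).1 (by simp [h.mem_nbr, hxz.symm, h2.symm])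
  have hxm' := (hs.mem x').1 (by simp [h'.mem_nbr, hxz'.symm, h3])
  simp only [Finset.mem_singleton] at hxm hxm'
  have s1 := same E F hs
  have s2 := same F E hs.symm
  have d1 := diff E F hs
  have d2 := diff F E hs.symm
  have cut : ∀ z x z' x', G.IsLeafAt S z x → G.IsLeafAt S z' x' → z ≠ z' → x = u →
      x' ≠ z → (∀ E F, G.IsSep ((S.erase z).erase z') E {u} F → x ∉ E → x' ∉ E → G.IsEnd S E) →
      ∀ E F, G.IsSep ((S.erase z).erase z') E {u} F → x' ∈ E → False := by
    intro z x z' x' h h' hz hx hxz hends E F hs hx'E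
    have hE := hs.left_subset
    have hF := hs.symm.left_subset
    have hxF := hs.notMem_right x
    have hxF' := hs.disj x' hx'E
    refine hS.2 {z} F (insert z' E) h.isEnd (hends F E hs.symm (by grind) hxF')
      ⟨?_, by simp, u, ?_⟩ ?_ ?_ ?_
    · have := h'.mem
      grind
    · intro e he v hv hev
      have e1 := h'.eq_of_adj v
      have e2 := hs.nbrsWithin e
      have e3 := h.eq_of_adj e
      have e4 := hev.symm
      have e5 := hs.notMem_left u
      grind
    · rw [Finset.disjoint_left]; grind
    · rw [Finset.disjoint_left]; grind
    · rw [Finset.disjoint_left]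
      have := hs.disj
      grind
  have c1 := cut z x z' x' h h' h1.symm
  have c2 := cut z' x' z x h' h h1
  rw [Finset.erase_right_comm] at c2
  by_cases hxu : x = u
  · rcases hxm' with hx | hx | hx
    · exact c1 hxu h3 hends E F hs hx
    · exact h4 (hx.trans hxu.symm)
    · exact c1 hxu h3 hends F E hs.symm hx
  by_cases hxu' : x' = u
  · rcases hxm with hx | hx | hx
    · exact c2 hxu' h2.symm (fun E F hs a b => hends E F hs b a) E F hs hx
    · exact hxu hx
    · exact c2 hxu' h2.symm (fun E F hs a b => hends E F hs b a) F E hs.symm hx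
  have := hd x
  have := hd x'
  tauto

/-- The neighbours of `x` other than `z` form a clique, so deleting `z` and `x` creates no cut
vertex and a path `z x y` can be removed. -/
theorem IsLeafAt.lambdaPartition_of_biconnOn {S : Finset V} {z x : V} (hcf : G.NoClaw)
    (hS : G.ChainOn S) (h : G.IsLeafAt S z x) (hB : G.BiconnOn (S.erase z)) (hcard : 3 ≤ S.card)
    (ih : G.PartitionsBelow S) (hdiv : 3 ∣ S.card) : G.LambdaPartition S := by
  have hx := h.cliqueNbrs_erase hcf hcard
  obtain ⟨y, hy, hxy⟩ := (h.isSep hcard).symm.exists_adj_of_connOn hS.1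
  have hyS : y ∈ S ∧ y ≠ z ∧ y ≠ x := by grind
  have hxz := h.adj.ne
  have c1 := Finset.card_erase_of_mem h.mem
  have c2 := Finset.card_erase_of_mem (show x ∈ S.erase z by simp [h.mem_nbr, hxz.symm])
  have c3 := Finset.card_erase_of_mem (show y ∈ (S.erase z).erase x by simp [hyS])
  have hp := ih _ (by omega) ((hB.erase_of_cliqueNbrs hx).chainOn_erase hcf y) (by omega)
  refine LambdaPartition.of_sdiff h.mem h.mem_nbr hyS.1 hyS.2.1.symm h.adj hxy ?_
  convert hp using 1
  ext v
  grind

/-! ### Two leaves on a graph without cut vertices -/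

/-- `S` arises from `B` by attaching leaves `z` and `z'` at `s` and `t`. -/
structure IsTwoLeafExtension (G : SimpleGraph V) (S B : Finset V) (z s z' t : V) : Prop where
  eq : S = insert z (insert z' B)
  ne : z ≠ z'
  notMem : z ∉ B
  notMem' : z' ∉ B
  adj : G.Adj z s
  adj' : G.Adj z' t
  mem : s ∈ B
  mem' : t ∈ B
  ne' : s ≠ t
  biconnOn : G.BiconnOn B
  cliqueNbrs : G.CliqueNbrs B s
  cliqueNbrs' : G.CliqueNbrs B t

theorem IsTwoLeafExtension.card {S B : Finset V} {z s z' t : V}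
    (h : G.IsTwoLeafExtension S B z s z' t) : S.card = B.card + 2 := by
  have := h.notMem
  have := h.notMem'
  have := h.ne
  rw [h.eq, Finset.card_insert_of_notMem (by grind), Finset.card_insert_of_notMem (by grind)]

theorem ChainBetween.lambdaPartition {S B X Y : Finset V} {z s z' t : V}
    (h : G.IsTwoLeafExtension S B z s z' t) (ih : G.PartitionsBelow S) (hdiv : 3 ∣ S.card)
    (hX : G.ChainBetween X s t) (hs : s ∈ X) (ht : t ∈ X) (hY : G.ChainOn Y) (hB : B = X ∪ Y)
    (hXY : Disjoint X Y) (hn : Y.Nonempty) (hY3 : 3 ∣ Y.card) : G.LambdaPartition S := by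
  have hcard := h.card
  have hpos := hn.card_pos
  rw [hB, Finset.card_union_of_disjoint hXY] at hcard
  have m := h.notMem
  have m' := h.notMem'
  have hne := h.ne
  have heq := h.eq
  have c : (insert z (insert z' X)).card = X.card + 2 := by
    rw [Finset.card_insert_of_notMem (by grind), Finset.card_insert_of_notMem (by grind)]
  have l1 := ih _ (by omega) (hX.chainOn_insert_insert hs ht h.adj h.adj') (by omega)
  have l2 := ih Y (by omega) hY hY3
  convert l1.union l2 (by
    rw [Finset.disjoint_left] at hXY ⊢
    grind) using 1
  rw [heq, hB]
  ext v
  simp only [Finset.mem_insert, Finset.mem_union]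
  tauto

/-- The middle part has a proper piece attached by at most two vertices away from the leaves. -/
def HasInnerSide (G : SimpleGraph V) (B : Finset V) (s t : V) (C : Finset V) : Prop :=
  C ⊆ B ∧ C.Nonempty ∧ s ∉ C ∧ t ∉ C ∧ (∃ a b, G.NbrsWithin B C {a, b}) ∧
    ∃ w ∈ B, w ∉ C ∧ w ≠ s ∧ w ≠ t

theorem IsTwoLeafExtension.not_nbrsWithin_singleton {S B C : Finset V} {z s z' t : V}
    (h : G.IsTwoLeafExtension S B z s z' t) (hC : C ⊆ B) (hn : C.Nonempty) (hs : s ∉ C)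
    (ht : t ∉ C) (u : V) : ¬ G.NbrsWithin B C {u} := by
  intro hu
  have := h.biconnOn C hC hn u hu
  have := this h.mem
  have := ‹B ⊆ _› h.mem'
  have := h.ne'
  grind

/-- According as `|C|` is 0, 1 or 2 modulo 3, none, both or one of the cut vertices join `C`; the
rest keeps the leaves. -/
theorem IsTwoLeafExtension.lambdaPartition_of_hasInnerSide {S B C : Finset V} {z s z' t : V}
    (hcf : G.NoClaw) (h : G.IsTwoLeafExtension S B z s z' t) (ih : G.PartitionsBelow S)
    (hdiv : 3 ∣ S.card) (hC : G.HasInnerSide B s t C)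
    (hmax : ∀ D, G.HasInnerSide B s t D → D.card ≤ C.card) : G.LambdaPartition S := by
  obtain ⟨hCB, hn, hsC, htC, ⟨a, b, hab⟩, w, hw, hwC, hws, hwt⟩ := hC
  have hone := h.not_nbrsWithin_singleton hCB hn hsC htC
  have ha : a ∈ B ∧ a ∉ C := by
    by_contra hcon
    refine hone b fun e he v hv hev => ?_
    have := hab e he v hv hev
    grind
  have hb : b ∈ B ∧ b ∉ C := by
    by_contra hcon
    refine hone a fun e he v hv hev => ?_
    have := hab e he v hv hev
    grind
  have hne : a ≠ b := by
    rintro rfl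
    exact hone a (by simpa using hab)
  have hst := h.ne'
  have hsB := h.mem
  have htB := h.mem'
  have hsep := isSep_of_nbrsWithin hCB (T := {a, b}) (by grind)
    (by rw [Finset.disjoint_left]; grind) hn (by
      intro hsub
      have := hsub hw
      have := hsub hsB
      have := hsub htB
      grind) hab
  -- A cut vertex has non-adjacent neighbours on the two sides, so `s` and `t` are not in the cut.
  have simp_notMem : ∀ a b, a ≠ b → ∀ R, G.IsSep B C {a, b} R → ¬ G.CliqueNbrs B a := by
    intro a b hne R hsep hcl
    obtain ⟨c, hc, hac⟩ := hsep.exists_adj_of_biconnOn h.biconnOn hne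
    obtain ⟨r, hr, har⟩ := hsep.symm.exists_adj_of_biconnOn h.biconnOn hne
    exact hsep.not_adj c hc r hr (hcl c (hsep.left_subset hc) r (hsep.symm.left_subset hr) hac har
      (fun e => hsep.disj c hc (e ▸ hr)))
  have na := simp_notMem a b hne _ hsep
  have nb := simp_notMem b a hne.symm _ hsep.swap
  generalize B \ (C ∪ {a, b}) = R at hsep na nb
  have hsR : s ∈ R := by
    have := (hsep.mem s).1 hsB
    have := h.cliqueNbrs
    grind
  have htR : t ∈ R := by
    have := (hsep.mem t).1 htB
    have := h.cliqueNbrs'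
    grind
  have hmax' : G.MaxSide B C s t := by
    intro D u v hCD hDB hsD htD hD x hx
    by_contra! hcon
    have := hmax D ⟨hDB, hn.mono hCD.1, hsD, htD, ⟨u, v, hD⟩, x, hx, hcon⟩
    have := Finset.card_lt_card hCD
    omega
  have haC := hsep.notMem_left a
  have hbC := hsep.notMem_left b
  have haR := hsep.notMem_right a
  have hbR := hsep.notMem_right b
  have hd := hsep.disj
  have hm := hsep.mem
  have ca : (insert a C).card = C.card + 1 := Finset.card_insert_of_notMem (by grind)
  have cab : (insert a (insert b C)).card = C.card + 2 := by
    rw [Finset.card_insert_of_notMem (by grind), Finset.card_insert_of_notMem (by grind)]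
  have h3 : C.card % 3 = 0 ∨ C.card % 3 = 1 ∨ C.card % 3 = 2 := by omega
  rcases h3 with h3 | h3 | h3
  · refine (hsep.chainBetween_insert_insert h.biconnOn hne hsR htR hst hmax').lambdaPartition h ih
      hdiv (by simp [hsR]) (by simp [htR])
      (hsep.chainOn_left_of_biconnOn hcf h.biconnOn hne) ?_ ?_ hn (by omega)
    · ext v; rw [hm]; grind
    · rw [Finset.disjoint_left]; grind
  · refine (hsep.chainBetween_right hcf h.biconnOn hne hsR htR hst hmax').lambdaPartition h ih
      hdiv hsR htR (hsep.chainOn_insert_insert h.biconnOn hne) ?_ ?_ (by simp) (by omega)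
    · ext v; rw [hm]; grind
    · rw [Finset.disjoint_left]; grind
  · refine (hsep.swap.chainBetween_insert hcf h.biconnOn hne.symm hsR htR hmax').lambdaPartition h
      ih hdiv (by simp [hsR]) (by simp [htR]) (hsep.chainOn_insert_one hcf h.biconnOn hne) ?_ ?_
      (by simp) (by omega)
    · ext v; rw [hm]; grind
    · rw [Finset.disjoint_left]; grind

theorem IsTwoLeafExtension.lambdaPartition_of_forall_not {S B : Finset V} {z s z' t : V}
    (h : G.IsTwoLeafExtension S B z s z' t) (ih : G.PartitionsBelow S)
    (hdiv : 3 ∣ S.card) (hno : ∀ C, ¬ G.HasInnerSide B s t C) (hcard : 6 ≤ S.card) :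
    G.LambdaPartition S := by
  have hc := h.card
  have hsB := h.mem
  have htB := h.mem'
  have hst := h.ne'
  have hz := h.notMem
  have hz' := h.notMem'
  have hzz := h.ne
  have heq := h.eq
  -- Otherwise `t` would cut `s` off from the other vertices of `B`, which has order at least 4.
  obtain ⟨y, hy, hyt, hsy⟩ : ∃ y ∈ B, y ≠ t ∧ G.Adj s y := by
    by_contra! hcon
    have := h.biconnOn {s} (by simpa using hsB) (by simp) t (fun e he v hv hev => by
      have := hcon v hv
      grind)
    have := Finset.card_le_card this
    have := Finset.card_le_two (a := t) (b := s)
    omega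
  have hys := hsy.ne'
  have hX := (h.biconnOn.erase_of_cliqueNbrs h.cliqueNbrs).connOn_erase (y := y)
  have htX : t ∈ (B.erase s).erase y := by grind
  have hT : G.ChainOn (insert z' ((B.erase s).erase y)) := by
    refine hX.chainOn_insert htX h.adj' fun E E' hE hE' d ht ht' => ?_
    -- Without a neighbour of `s`, the end would be attached in `B` by `u` and `y`, hence an inner
    -- side omitting `y`.
    have key : ∀ E, G.IsEnd ((B.erase s).erase y) E → t ∉ E → ∃ e ∈ E, G.Adj s e := by
      rintro E ⟨hE, hn, u, hu⟩ ht
      by_contra! hcon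
      have hsE : s ∉ E := fun hs => by have := hE hs; grind
      have hyE : y ∉ E := fun hy => by have := hE hy; grind
      refine hno E ⟨fun v hv => by have := hE hv; grind, hn, hsE, ht, ⟨u, y, ?_⟩,
        y, hy, hyE, hys, hyt⟩
      intro e he v hv hev
      have := hu e he v
      have := hcon e he
      have := hev.symm
      grind
    obtain ⟨e, he, hse⟩ := key E hE ht
    obtain ⟨e', he', hse'⟩ := key E' hE' ht'
    have := hX.subset_union hE hE' d he he' (h.cliqueNbrs e (by have := hE.1 he; grind) e'
      (by have := hE'.1 he'; grind) hse hse' (Finset.disjoint_iff_ne.1 d e he e' he'))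
    have := this htX
    grind
  have c1 := Finset.card_erase_of_mem hsB
  have c2 := Finset.card_erase_of_mem (show y ∈ B.erase s by grind)
  have c3 : (insert z' ((B.erase s).erase y)).card = ((B.erase s).erase y).card + 1 :=
    Finset.card_insert_of_notMem (by grind)
  have hp := ih _ (by omega) hT (by omega)
  refine LambdaPartition.of_sdiff (x := z) (y := s) (z := y) (by grind) (by grind) (by grind)
    (by grind) h.adj hsy ?_
  convert hp using 1
  rw [heq]
  ext v
  grind

theorem IsTwoLeafExtension.lambdaPartition {S B : Finset V} {z s z' t : V} (hcf : G.NoClaw)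
    (h : G.IsTwoLeafExtension S B z s z' t) (ih : G.PartitionsBelow S)
    (hdiv : 3 ∣ S.card) (hcard : 6 ≤ S.card) : G.LambdaPartition S := by
  classical
  by_cases hno : ∀ C, ¬ G.HasInnerSide B s t C
  · exact h.lambdaPartition_of_forall_not ih hdiv hno hcard
  · push Not at hno
    obtain ⟨C₀, hC₀⟩ := hno
    obtain ⟨C, hC, hmax⟩ := (B.powerset.filter (G.HasInnerSide B s t)).exists_max_image
      Finset.card ⟨C₀, by simp [hC₀, hC₀.1]⟩
    exact h.lambdaPartition_of_hasInnerSide hcf ih hdiv (Finset.mem_filter.1 hC).2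
      fun D hD => hmax D (by simp [hD, hD.1])

/-! ### The partition theorem for chains -/

/-- A claw-free graph whose blocks form a chain and whose order is divisible by three
can be partitioned into paths on three vertices. -/
theorem ChainOn.lambdaPartition (hcf : G.NoClaw) {S : Finset V} (hS : G.ChainOn S)
    (hdiv : 3 ∣ S.card) : G.LambdaPartition S := by
  induction hn : S.card using Nat.strong_induction_on generalizing S with
  | _ n ihn =>
    have ih : G.PartitionsBelow S := fun T hT hc hd => ihn _ (hn ▸ hT) hc hd rfl
    by_cases h0 : S.card = 0
    · rw [Finset.card_eq_zero.1 h0]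
      exact .empty
    by_cases h3 : S.card = 3
    · exact hS.1.lambdaPartition_of_card h3
    have h6 : 6 ≤ S.card := by omega
    by_cases hB : G.BiconnOn S
    · by_cases hT : G.TriconnOn S
      · exact hT.lambdaPartition hcf (by omega) ih hdiv
      · obtain ⟨E, u, v, R, huv, hs⟩ := hB.exists_isSep hT
        exact hs.lambdaPartition_of_biconnOn hcf hB huv ih hdiv
    by_cases hcut : G.OnlyTrivialCuts S
    swap
    · simp only [OnlyTrivialCuts] at hcut
      push Not at hcut
      obtain ⟨L, x, R, hs, hL, hR⟩ := hcut
      exact hs.lambdaPartition_of_chainOn hcf hS hL hR ih hdiv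
    obtain ⟨z, x, hz⟩ : ∃ z x, G.IsLeafAt S z x := by
      obtain ⟨E, u, F, hs⟩ := hS.1.exists_isSep hB
      rcases hcut _ _ _ hs with h | h
      · obtain ⟨z, -, hz⟩ := hs.exists_isLeafAt hS.1 h
        exact ⟨z, u, hz⟩
      · obtain ⟨z, -, hz⟩ := hs.symm.exists_isLeafAt hS.1 h
        exact ⟨z, u, hz⟩
    by_cases hB' : G.BiconnOn (S.erase z)
    · exact hz.lambdaPartition_of_biconnOn hcf hS hB' (by omega) ih hdiv
    obtain ⟨z', x', hz', h1, h2, h3, h4⟩ := hz.exists_second_leaf hS hcut hB'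
    have m := hz.mem
    have m' := hz'.mem
    have n := hz.mem_nbr
    have n' := hz'.mem_nbr
    have a := hz.adj.ne
    have a' := hz'.adj.ne
    have hext : G.IsTwoLeafExtension S ((S.erase z).erase z') z x z' x' :=
      { eq := by ext v; grind
        ne := h1.symm
        notMem := by simp
        notMem' := by simp
        adj := hz.adj
        adj' := hz'.adj
        mem := by grind
        mem' := by grind
        ne' := h4.symm
        biconnOn := hz.biconnOn_erase_erase hS hcut hz' h1 h2 h3 h4
        cliqueNbrs := (hz.cliqueNbrs_erase hcf (by omega)).mono (Finset.erase_subset _ _)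
        cliqueNbrs' := (hz'.cliqueNbrs_erase hcf (by omega)).mono (by
          rw [Finset.erase_right_comm]; exact Finset.erase_subset _ _) }
    exact hext.lambdaPartition hcf ih hdiv h6

end SimpleGraph

/-! ### From the graph to vertex sets and back -/

namespace SimpleGraph

variable {V : Type*}

theorem IsClawFree.noClaw {G : SimpleGraph V} (h : G.IsClawFree) : G.NoClaw := by
  intro y a b c hya hyb hyc hab hac hbc
  by_contra! hcon
  obtain ⟨h1, h2, h3⟩ := hcon
  have h1' : ¬ G.Adj b a := fun h => h1 h.symm
  have h2' : ¬ G.Adj c a := fun h => h2 h.symm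
  have h3' : ¬ G.Adj c b := fun h => h3 h.symm
  refine h ⟨⟨⟨Sum.elim (fun _ => y) ![a, b, c], ?_⟩, ?_⟩⟩
  · rintro (i | i) (j | j) hij
    · exact congrArg _ (Subsingleton.elim _ _)
    · fin_cases j <;> simp_all
    · fin_cases i <;> simp_all
    · fin_cases i <;> fin_cases j <;> simp_all
  · intro u v
    change G.Adj (Sum.elim (fun _ : Fin 1 => y) ![a, b, c] u)
      (Sum.elim (fun _ : Fin 1 => y) ![a, b, c] v) ↔ _
    rcases u with i | i <;> rcases v with j | j
    · simp
    · fin_cases j <;> simp_all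
    · fin_cases i <;> simp_all [G.adj_comm]
    · fin_cases i <;> fin_cases j <;> simp_all

theorem IsVertexConnected.triconnOn_univ [Fintype V] [DecidableEq V] {G : SimpleGraph V}
    (h : G.IsVertexConnected 3) : G.TriconnOn Finset.univ := by
  intro E _ hn u v hE w _
  by_contra hw
  obtain ⟨e, he⟩ := hn
  -- Since `u` or `v` may lie in `E`, only those outside `E` are deleted; `e` survives and no walk
  -- leaves `E`.
  have hT : (({u, v} : Finset V) \ E).card < 3 :=
    (Finset.card_le_card Finset.sdiff_subset).trans_lt
      (Finset.card_le_two.trans_lt (by norm_num))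
  obtain ⟨p⟩ := (h.2 _ hT).preconnected ⟨e, by simp [he]⟩ ⟨w, by simp; grind⟩
  have key : ∀ x y, (G.induce (((({u, v} : Finset V) \ E : Finset V) : Set V)ᶜ)).Walk x y →
      (x : V) ∈ E → (y : V) ∈ E := by
    intro x y p
    induction p with
    | nil => exact id
    | @cons x' y' z' hadj _ ih =>
      intro hx
      refine ih ?_
      have := hE _ hx y' (Finset.mem_univ _) hadj
      have := y'.2
      simp at this
      grind
  have := key _ _ p he
  grind

theorem TriconnOn.chainOn_sdiff [Fintype V] [DecidableEq V] {G : SimpleGraph V} (hcf : G.NoClaw)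
    (hG : G.TriconnOn Finset.univ) {a b c d : V} (hca : G.Adj c a) (hcb : G.Adj c b)
    (hab : a ≠ b)
    (hd : ∀ v, G.Adj c v → v = a ∨ v = b ∨ v = d) :
    G.ChainOn (Finset.univ \ {a, b, c}) := by
  have ne1 := hca.ne
  have ne2 := hcb.ne
  have hc : G.ConnOn (Finset.univ \ {a, b, c}) := by
    -- A closed set avoiding `d` has no neighbour of `c`, so `{a, b}` would separate it from `c`.
    refine connOn_of_avoid d fun E hE hn hn' hdE hb => ?_
    have hmem : ∀ e ∈ E, e ≠ a ∧ e ≠ b ∧ e ≠ c := fun e he => by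
      have := hE he
      grind
    have := hG E (Finset.subset_univ _) hn a b (fun e he v hv hev => by
      have := hb e he v
      have := hd e
      have := hev.symm
      grind)
    have := this (Finset.mem_univ c)
    grind
  refine chainOn_of_conn hc (fun E => d ∈ E) (fun E => d ∉ E) (fun E _ => em _) ?_ ?_
  · intro E E' E'' _ _ _ dd _ _ h1 h2
    exact Finset.disjoint_left.1 dd h1 h2
  · have key : ∀ E, G.IsEnd (Finset.univ \ {a, b, c}) E → d ∉ E →
        ∃ e ∈ E, G.Adj a e ∧ ¬ G.Adj c e ∧ e ≠ c := by
      rintro E ⟨hE, hn, u, hu⟩ hdE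
      have hmem : ∀ e ∈ E, e ≠ a ∧ e ≠ b ∧ e ≠ c := fun e he => by
        have := hE he
        grind
      have hnc : ∀ e ∈ E, ¬ G.Adj c e := fun e he hce => by
        have := hd e hce
        grind
      by_contra! hcon
      have := hG E (Finset.subset_univ _) hn u b (fun e he v hv hev => by
        have := hu e he v
        have := hnc e he
        have := hcon e he
        have := hev.symm
        grind)
      have h1 := this (Finset.mem_univ c)
      have h2 := this (Finset.mem_univ a)
      have := hmem a
      have := hmem c
      grind
    intro E E' E'' h1 h2 h3 dd d' d'' hE hE'
    obtain ⟨e, he, hae, hce, hec⟩ := key E h1 hE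
    obtain ⟨e', he', hae', hce', hec'⟩ := key E' h2 hE'
    rcases hcf a c e e' hca.symm hae hae' hec.symm hec'.symm
      (Finset.disjoint_iff_ne.1 dd e he e' he') with h | h | h
    · exact hce h
    · exact hce' h
    · exact hc.not_adj_ends h1 h2 h3.1 h3.2.1 dd d' d'' he he' h

theorem ConnOn.connected_induce [DecidableEq V] {G : SimpleGraph V} {S : Finset V}
    (hS : G.ConnOn S) (hn : S.Nonempty) {W : Set V} (hW : ∀ v, v ∈ S ↔ v ∈ W) :
    (G.induce W).Connected := by
  classical
  have : Nonempty W := by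
    obtain ⟨v, hv⟩ := hn
    exact ⟨⟨v, (hW v).1 hv⟩⟩
  refine ⟨fun x y => ?_⟩
  have := hS (S.filter fun v => ∃ h : v ∈ W, (G.induce W).Reachable x ⟨v, h⟩)
    (Finset.filter_subset _ _) ⟨x, by simp [(hW x).2 x.2]⟩ (by
      intro e he v hv hev
      obtain ⟨-, h, hr⟩ := Finset.mem_filter.1 he
      refine .inl (Finset.mem_filter.2 ⟨hv, (hW v).1 hv, hr.trans (Adj.reachable ?_)⟩)
      exact hev)
  obtain ⟨-, _, h⟩ := Finset.mem_filter.1 (this ((hW y).2 y.2))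
  exact h

theorem LambdaPartition.exists_family [DecidableEq V] {G : SimpleGraph V} {S : Finset V}
    (h : G.LambdaPartition S) : ∃ (ι : Type) (p : ι × Fin 3 → V), Function.Injective p ∧
      (∀ v, v ∈ S ↔ ∃ i, p i = v) ∧ ∀ i, G.Adj (p (i, 0)) (p (i, 1)) ∧
        G.Adj (p (i, 1)) (p (i, 2)) := by
  induction h with
  | empty => exact ⟨Empty, fun i => i.1.elim, fun i => i.1.elim, by simp, fun i => i.elim⟩
  | @insert S x y z hx hy hz hxz hxy hyz _ ih =>
    obtain ⟨ι, p, hp, hS, hadj⟩ := ih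
    have hne1 := hxy.ne
    have hne2 := hyz.ne
    have hmem : ∀ i, p i ∈ S := fun i => (hS _).2 ⟨i, rfl⟩
    have ht : ∀ k, ![x, y, z] k ∉ S := by
      intro k
      fin_cases k <;> simpa
    refine ⟨Option ι, fun q => q.1.elim (![x, y, z] q.2) fun i => p (i, q.2), ?_, ?_, ?_⟩
    · rintro ⟨_ | i, k⟩ ⟨_ | j, l⟩ hkl
      · have : k = l := by
          fin_cases k <;> fin_cases l <;> simp_all
        rw [this]
      · exact absurd (by simpa [show ![x, y, z] k = p (j, l) from hkl] using hmem (j, l)) (ht k)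
      · exact absurd (by simpa [show p (i, k) = ![x, y, z] l from hkl] using hmem (i, k)) (ht l)
      · have := hp (show p (i, k) = p (j, l) from hkl)
        simp_all
    · intro v
      constructor
      · intro hv
        simp only [Finset.mem_insert] at hv
        rcases hv with rfl | rfl | rfl | hv
        · exact ⟨(none, 0), rfl⟩
        · exact ⟨(none, 1), rfl⟩
        · exact ⟨(none, 2), rfl⟩
        · obtain ⟨⟨i, k⟩, rfl⟩ := (hS v).1 hv
          exact ⟨(some i, k), rfl⟩
      · rintro ⟨⟨_ | i, k⟩, rfl⟩
        · fin_cases k <;> simp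
        · have := hmem (i, k)
          simp [this]
    · rintro (_ | i)
      · exact ⟨hxy, hyz⟩
      · exact hadj i

/-- The factor is the image of disjoint copies of the path. Walks preserve the first coordinate, so
its components are exactly the copies. -/
theorem hasLambdaFactor_of_equiv {G : SimpleGraph V} {ι : Type*} (e : ι × Fin 3 ≃ V)
    (he : ∀ i, G.Adj (e (i, 0)) (e (i, 1)) ∧ G.Adj (e (i, 1)) (e (i, 2))) :
    G.HasLambdaFactor := by
  let P : G.Subgraph :=
    { verts := Set.univ
      Adj u v := (e.symm u).1 = (e.symm v).1 ∧ (pathGraph 3).Adj (e.symm u).2 (e.symm v).2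
      adj_sub := by
        intro u v
        obtain ⟨⟨i, k⟩, rfl⟩ := e.surjective u
        obtain ⟨⟨j, l⟩, rfl⟩ := e.surjective v
        rintro ⟨hij, hkl⟩
        simp only [Equiv.symm_apply_apply] at hij hkl
        subst hij
        have := he i
        have := (he i).1.symm
        have := (he i).2.symm
        rw [pathGraph_adj] at hkl
        fin_cases k <;> fin_cases l <;> simp_all
      edge_vert := fun _ => Set.mem_univ _
      symm := ⟨fun _ _ h => ⟨h.1.symm, h.2.symm⟩⟩ }
  have hadj : ∀ i k l, (pathGraph 3).Adj k l →
      P.coe.Adj ⟨e (i, k), Set.mem_univ _⟩ ⟨e (i, l), Set.mem_univ _⟩ := by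
    intro i k l hkl
    exact ⟨by simp, by simpa using hkl⟩
  have hwalk : ∀ u v : P.verts, P.coe.Walk u v → (e.symm u).1 = (e.symm v).1 := by
    intro u v p
    induction p with
    | nil => rfl
    | cons h _ ih => exact h.1.trans ih
  refine ⟨P, fun c => ?_, fun v => Set.mem_univ v⟩
  induction c using ConnectedComponent.ind with
  | _ v =>
    obtain ⟨v, hv⟩ := v
    obtain ⟨⟨i, k⟩, rfl⟩ := e.surjective v
    have hconn : ∀ l, P.coe.Reachable ⟨e (i, l), Set.mem_univ _⟩ ⟨e (i, k), hv⟩ := by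
      intro l
      -- `pathGraph_connected n` speaks of `pathGraph (n + 1)`.
      obtain ⟨p⟩ := (pathGraph_connected 2).preconnected l k
      induction p with
      | nil => exact Reachable.refl _
      | cons h _ ih => exact (hadj i _ _ h).reachable.trans (ih _)
    refine ⟨(RelIso.symm ⟨Equiv.ofBijective (fun l : Fin 3 =>
      ⟨⟨e (i, l), Set.mem_univ _⟩, ConnectedComponent.sound (hconn l)⟩) ⟨?_, ?_⟩, ?_⟩)⟩
    · intro l l' hl
      have : e (i, l) = e (i, l') := congrArg (fun x => (x.1 : V)) hl
      simpa using this
    · rintro ⟨⟨w, hw⟩, hwc⟩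
      obtain ⟨⟨j, l⟩, rfl⟩ := e.surjective w
      obtain ⟨p⟩ := ConnectedComponent.exact hwc
      have := hwalk _ _ p
      simp only [Equiv.symm_apply_apply] at this
      exact ⟨l, by simp [this]⟩
    · intro l l'
      constructor
      · intro h
        have h2 : (pathGraph 3).Adj (e.symm (e (i, l))).2 (e.symm (e (i, l'))).2 := h.2
        simpa using h2
      · intro h
        exact hadj i l l' h

theorem LambdaPartition.hasLambdaFactor_induce [DecidableEq V] {G : SimpleGraph V} {S : Finset V}
    (h : G.LambdaPartition S) {W : Set V} (hW : ∀ v, v ∈ S ↔ v ∈ W) :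
    (G.induce W).HasLambdaFactor := by
  obtain ⟨ι, p, hp, hS, hadj⟩ := h.exists_family
  refine hasLambdaFactor_of_equiv (Equiv.ofBijective
    (fun q => (⟨p q, (hW _).1 ((hS _).2 ⟨q, rfl⟩)⟩ : W)) ⟨?_, ?_⟩) hadj
  · intro q q' h
    exact hp (congrArg Subtype.val h)
  · rintro ⟨w, hw⟩
    obtain ⟨q, hq⟩ := (hS w).1 ((hW w).2 hw)
    exact ⟨q, Subtype.ext hq⟩

end SimpleGraph

/-- `L` is a 3-vertex path in `G` (a subgraph, not necessarily induced), `φ` labels its vertices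
`0, 1, 2` along the path, so that `φ 1` is its centre; `G - L` is obtained by deleting the
vertices of `L`. -/
theorem mainTheorem10 {V : Type*} [Fintype V] (G : SimpleGraph V) [DecidableRel G.Adj]
    (hconn : G.IsVertexConnected 3) (hclaw : G.IsClawFree)
    (hmod : Fintype.card V % 3 = 0)
    (L : G.Subgraph) (φ : SimpleGraph.pathGraph 3 ≃g L.coe)
    (hdeg : G.degree (φ 1 : V) = 3) :
    (G.induce (L.vertsᶜ)).Connected ∧ (G.induce (L.vertsᶜ)).HasLambdaFactor := by
  classical
  have hinj : ∀ i j, (φ i : V) = φ j → i = j := fun i j h => φ.injective (Subtype.ext h)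
  have hadj : ∀ i j, (SimpleGraph.pathGraph 3).Adj i j → G.Adj (φ i : V) (φ j) := fun i j h =>
    L.adj_sub (φ.map_rel_iff.2 h)
  have hca : G.Adj (φ 1 : V) (φ 0) := hadj 1 0 (by simp [SimpleGraph.pathGraph_adj])
  have hcb : G.Adj (φ 1 : V) (φ 2) := hadj 1 2 (by simp [SimpleGraph.pathGraph_adj])
  have hab : (φ 0 : V) ≠ φ 2 := fun h => by simpa using hinj _ _ h
  obtain ⟨d, hd⟩ : ∃ d, ∀ v, G.Adj (φ 1 : V) v → v = φ 0 ∨ v = φ 2 ∨ v = d := by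
    have hc : ((G.neighborFinset (φ 1 : V)).erase (φ 0)).card = 2 := by
      rw [Finset.card_erase_of_mem (by simpa using hca), G.card_neighborFinset_eq_degree, hdeg]
    have hc' : (((G.neighborFinset (φ 1 : V)).erase (φ 0)).erase (φ 2)).card = 1 := by
      rw [Finset.card_erase_of_mem (by simp [hab.symm, hcb]), hc]
    obtain ⟨d, hd⟩ := Finset.card_eq_one.1 hc'
    refine ⟨d, fun v hv => ?_⟩
    have := Finset.ext_iff.1 hd v
    simp only [Finset.mem_erase, SimpleGraph.mem_neighborFinset, Finset.mem_singleton] at this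
    tauto
  have hchain := hconn.triconnOn_univ.chainOn_sdiff hclaw.noClaw hca hcb hab hd
  have hW : ∀ v, v ∈ Finset.univ \ {(φ 0 : V), (φ 2 : V), (φ 1 : V)} ↔ v ∈ L.vertsᶜ := by
    intro v
    rw [Finset.mem_sdiff, Set.mem_compl_iff]
    simp only [Finset.mem_univ, true_and, Finset.mem_insert, Finset.mem_singleton, not_iff_not]
    constructor
    · rintro (rfl | rfl | rfl) <;> exact Subtype.coe_prop _
    · intro hv
      obtain ⟨k, hk⟩ := φ.surjective ⟨v, hv⟩
      have hk' : (φ k : V) = v := congrArg Subtype.val hk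
      subst hk'
      fin_cases k <;> simp
  have hcard : (Finset.univ \ {(φ 0 : V), (φ 2 : V), (φ 1 : V)}).card = Fintype.card V - 3 := by
    rw [Finset.card_sdiff_of_subset (Finset.subset_univ _), Finset.card_univ,
      Finset.card_eq_three.2 ⟨_, _, _, hab, hca.ne', hcb.ne', rfl⟩]
  have h3 : 3 < Fintype.card V := by
    have := hconn.1
    rw [ENat.card_eq_coe_fintype_card] at this
    exact_mod_cast this
  exact ⟨hchain.1.connected_induce (Finset.card_pos.1 (by omega)) hW,
    (hchain.lambdaPartition hclaw.noClaw (by omega)).hasLambdaFactor_induce hW⟩
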